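/- Let $\zeta$ be the Riemann zeta function, $\kappa=\pi\sqrt{2/3}$, $\mathfrak z=\pi^2/6$, and define $$\eta(s)=(\kappa/\mathfrak z)^s\,(1-2^{-s-1})\,\zeta(s+1),\qquad H(s)=\eta(s)\,\frac{\zeta(2s)}{\zeta(s)}\,\Gamma(s).$$ Assume the Riemann Hypothesis, and assume that all zeros of $\zeta$ in the strip $0<\operatorname{Re}(s)<1$ are simple. Then for all $\sigma>1/2$ and $x>0$ the integral $$\phi_0(x)=\frac1{2\pi i}\int_{\sigma-i\infty}^{\sigma+i\infty}H(s)\,x^{s/2}\,ds$$ converges absolutely. Moreover, put $$\mathfrak c_0=-\operatorname{Res}_{s=1/2}H(s),\qquad \mathfrak c_\rho=\operatorname{Res}_{s=\rho}H(s)$$ for the zeros $\rho=\tfrac12+i\gamma$ ($\gamma\in\mathbb R$) of $\zeta$. Then $$\mathfrak c_0=-\frac12\cdot\frac{\eta(1/2)}{\zeta(1/2)}\,\Gamma(1/2),\qquad \mathfrak c_\rho=\eta(\rho)\,\frac{\zeta(2\rho)}{\zeta'(\rho)}\,\Gamma(\rho),$$ and there are constants $x_0$ and $C$ such that for every $x>x_0$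 there is a real number $T_x$ with $\log x\le T_x\le \log x+1$ such that, for every choice of $\sigma>1/2$ in the definition of $\phi_0(x)$, $$\Bigl|\,\phi_0(x)-\Bigl(-\mathfrak c_0\,x^{1/4}+\sum_{|\gamma|<T_x}\mathfrak c_\rho\,x^{\rho/2}\Bigr)\Bigr|\le C\,x^{1/6}.$$ Here the sum runs over the zeros $\rho=\tfrac12+i\gamma$ of $\zeta$ with $|\gamma|<T_x$. -/

import Mathlib

noncomputable section

namespace LiouvillePhi

/-- The residue of `f` at `a`: the limit, as the radius tends to `0` from above, of the
normalized contour integrals of `f` over circles about `a`. -/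
def residue (f : ℂ → ℂ) (a : ℂ) : ℂ :=
  Filter.limUnder (nhdsWithin (0 : ℝ) (Set.Ioi 0))
    (fun r : ℝ => (2 * (Real.pi : ℂ) * Complex.I)⁻¹ * ∮ z in C(a, r), f z)

/-- `κ = π √(2/3)`. -/
def kappa : ℝ := Real.pi * Real.sqrt (2 / 3)

/-- `𝔷 = ζ(2) = π² / 6`. -/
def zetaTwo : ℝ := Real.pi ^ 2 / 6

/-- `η(s) = (κ / 𝔷)^s (1 - 2^(-s-1)) ζ(s+1)`. -/
def eta (s : ℂ) : ℂ :=
  ((kappa / zetaTwo : ℝ) : ℂ) ^ s * (1 - (2 : ℂ) ^ (-s - 1)) * riemannZeta (s + 1)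

/-- `H(s) = η(s) (ζ(2s) / ζ(s)) Γ(s)`. -/
def H (s : ℂ) : ℂ :=
  eta s * (riemannZeta (2 * s) / riemannZeta s) * Complex.Gamma s

/-- The integrand of `φ₀(x)` on the vertical line `Re s = σ`, as a function of `t = Im s`. -/
def phi0Integrand (σ x t : ℝ) : ℂ :=
  H ((σ : ℂ) + (t : ℂ) * Complex.I) * (x : ℂ) ^ (((σ : ℂ) + (t : ℂ) * Complex.I) / 2)

/-- `φ₀(x) = (1 / 2πi) ∫ H(s) x^(s/2) ds` over the vertical line `Re s = σ`
(parametrized as `s = σ + i t`, so that `ds = i dt`). -/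
def phi0 (σ x : ℝ) : ℂ :=
  (2 * (Real.pi : ℂ))⁻¹ * ∫ t : ℝ, phi0Integrand σ x t

/-- `𝔠_ρ`, the residue of `H` at `ρ`. -/
def cRes (ρ : ℂ) : ℂ := residue H ρ

/-- `𝔠₀`, minus the residue of `H` at `1/2`. -/
def cZero : ℂ := -residue H (1 / 2)

/-- The Simplicity Hypothesis: every zero of `ζ` in the strip `0 < Re s < 1` is simple. -/
def SimplicityHypothesis : Prop :=
  ∀ ρ : ℂ, 0 < ρ.re → ρ.re < 1 → riemannZeta ρ = 0 → analyticOrderAt riemannZeta ρ = 1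

/-- The zeros `ρ = 1/2 + iγ` of `ζ` on the critical line with `|γ| < T`. -/
def criticalZeroSet (T : ℝ) : Set ℂ :=
  {ρ : ℂ | riemannZeta ρ = 0 ∧ ρ.re = 1 / 2 ∧ |ρ.im| < T}

lemma criticalZeroSet_finite (T : ℝ) : (criticalZeroSet T).Finite := by
  refine ((isCompact_closedBall (0 : ℂ) (1 + |T|)).inter_riemannZetaZeros_finite).subset ?_
  rintro ρ ⟨hz, hre, him⟩
  refine ⟨?_, hz⟩
  rw [mem_closedBall_zero_iff]
  refine (Complex.norm_le_abs_re_add_abs_im ρ).trans ?_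
  have h2 := le_abs_self T
  rw [hre, abs_of_pos (by norm_num : (0 : ℝ) < 1 / 2)]
  linarith

/-- The zeros `ρ = 1/2 + iγ` of `ζ` with `|γ| < T`, as a finite set. -/
def criticalZeros (T : ℝ) : Finset ℂ := (criticalZeroSet_finite T).toFinset

end LiouvillePhi

end

/-!
The estimate is a contour shift. With `F(s) = H(s) x^(s/2)`, the integral of `F` over a line
`Re s = σ > 1/2` is moved to `Re s = 1/3`, where `|x^(s/2)| = x^(1/6)`. Under RH and simplicity the
only poles passed are `1/2` (from `ζ(2s)`) and the zeros `ρ` of `ζ`, all simple; at `1/2` one needs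
`ζ(1/2) ≠ 0`. The singularity at `s = 1` is removable, and `Hext` is `H` with the correct value
there.

Since `Γ` decays like `e^(-π|t|/2)` while `e^(-T) ≤ 1/x` for `T ≥ log x`, the tails and the
horizontal segments at height `T` are `O(1)` as soon as `1/|ζ(s)| ≤ e^(|t|/4)` there; this leaves
much room, and no sharp bound for `1/ζ` is needed. The bound (`exists_exp_neg_le_norm_riemannZeta`)
holds at every point at distance at least `1/(A log |t|)` from the zeros:

* `ζ` has polynomial growth in vertical strips (`exists_norm_riemannZeta_le`), by
  `ζ(s) = s/(s-1) - s ∫₁^∞ {t} t^(-s-1) dt` and the functional equation;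
* a holomorphic function `f` with `|f| ≤ e^L |f(c)|` on a disk about `c` has `O(L)` zeros in a
  smaller disk, and `|f| ≥ |f(c)| e^(-O(L)) d^(O(L))` at distance `d` from them
  (`exists_zeros_and_lower_bound`), by Borel–Carathéodory applied to the zero-free cofactor. For `ζ`
  and `c = 2 + it`, `L = O(log |t|)`, so the loss is at most `exp (O((log |t|)²))`.

On a line `Re s = σ ≠ 1/2` the distance condition is automatic for large `|t|`, which gives absolute
convergence, the independence of `σ` and the convergence on `Re s = 1/3`. On the horizontal segments
it holds for a suitable `T` in each unit interval far enough out, because only `O(log T)` zeros have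
ordinates nearby (`exists_height`).
-/

namespace LiouvillePhi

open Complex Filter Topology Set MeasureTheory Metric
open scoped Nat

/-! ### Decay of the Gamma function on vertical lines -/

lemma mul_norm_le_norm_mul {a b : ℝ} (t : ℝ) (ha : 0 ≤ a) (hab : a ≤ b) :
    a * ‖(b + t * I : ℂ)‖ ≤ ‖(a + t * I : ℂ)‖ * b := by
  rw [norm_add_mul_I, norm_add_mul_I]
  refine abs_le_of_sq_le_sq' ?_ (mul_nonneg (Real.sqrt_nonneg _) (ha.trans hab)) |>.2
  rw [mul_pow, mul_pow, Real.sq_sqrt (by positivity), Real.sq_sqrt (by positivity)]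
  have : a ^ 2 ≤ b ^ 2 := by gcongr
  nlinarith [sq_nonneg t, mul_le_mul_of_nonneg_right this (sq_nonneg t)]

/-- For fixed `t`, the ratio `|Γ(σ + it)| / Γ(σ)` is nondecreasing in `σ > 0`: each factor
`(σ + j) / |σ + j + it|` of Euler's product is. -/
lemma norm_Gamma_mul_le {σ τ : ℝ} (t : ℝ) (hσ : 0 < σ) (hστ : σ ≤ τ) :
    ‖Gamma (σ + t * I)‖ * Real.Gamma τ ≤ Real.Gamma σ * ‖Gamma (τ + t * I)‖ := by
  have h1 := ((GammaSeq_tendsto_Gamma (σ + t * I)).norm).mul (Real.GammaSeq_tendsto_Gamma τ)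
  have h2 := (Real.GammaSeq_tendsto_Gamma σ).mul ((GammaSeq_tendsto_Gamma (τ + t * I)).norm)
  refine le_of_tendsto_of_tendsto h1 h2 ?_
  filter_upwards [eventually_gt_atTop 0] with n hn
  have hτ : 0 < τ := hσ.trans_le hστ
  have key (u : ℝ) : ‖GammaSeq (u + t * I) n‖
      = (n : ℝ) ^ u * n ! / ∏ j ∈ Finset.range (n + 1), ‖((u + j : ℝ) + t * I : ℂ)‖ := by
    rw [GammaSeq, norm_div, norm_mul, norm_natCast_cpow_of_pos hn, norm_prod, norm_natCast]
    simp only [add_re, ofReal_re, mul_re, I_re, mul_zero, ofReal_im, I_im, mul_one, sub_self,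
      add_zero]
    congr 1
    refine Finset.prod_congr rfl fun j _ => ?_
    congr 1
    push_cast
    ring
  have hpos (u : ℝ) (hu : 0 < u) :
      0 < ∏ j ∈ Finset.range (n + 1), ‖((u + j : ℝ) + t * I : ℂ)‖ := by
    refine Finset.prod_pos fun j _ => norm_pos_iff.2 fun h => ?_
    have h3 := congrArg re h
    simp only [add_re, ofReal_re, mul_re, I_re, mul_zero, ofReal_im, I_im, mul_one, sub_self,
      add_zero, zero_re] at h3
    have h4 : (0 : ℝ) ≤ j := j.cast_nonneg
    linarith
  have hpos' (u : ℝ) (hu : 0 < u) : 0 < ∏ j ∈ Finset.range (n + 1), (u + j) :=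
    Finset.prod_pos fun j _ => by positivity
  rw [key, key, Real.GammaSeq, Real.GammaSeq, div_mul_div_comm, div_mul_div_comm]
  refine div_le_div_of_nonneg_left (by positivity)
    (mul_pos (hpos' σ hσ) (hpos τ hτ)) ?_
  rw [← Finset.prod_mul_distrib, ← Finset.prod_mul_distrib]
  refine Finset.prod_le_prod (fun j _ => by positivity) fun j _ => ?_
  exact mul_norm_le_norm_mul t (by positivity) (by linarith)

/-- From `|Γ(1 + it)|² = πt / sinh(πt)`. -/
lemma norm_Gamma_one_add_le {t : ℝ} (ht : 1 ≤ |t|) :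
    ‖Gamma ((1 : ℝ) + t * I)‖ ≤ 4 * |t| * Real.exp (-(Real.pi / 2) * |t|) := by
  have hconj : Gamma (1 - t * I) = (starRingEnd ℂ) (Gamma ((1 : ℝ) + t * I)) := by
    rw [← Gamma_conj]
    congr 1
    simp [sub_eq_add_neg]
  have ht0 : t ≠ 0 := by rintro rfl; norm_num at ht
  have hrec : Gamma ((1 : ℝ) + t * I) = t * I * Gamma (t * I) := by
    rw [ofReal_one, add_comm, Gamma_add_one _ (by simp [ht0])]
  have hprod := Gamma_mul_Gamma_one_sub (t * I)
  have hsq : ‖Gamma ((1 : ℝ) + t * I)‖ ^ 2 = |t| * (Real.pi / |Real.sinh (Real.pi * t)|) := by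
    calc ‖Gamma ((1 : ℝ) + t * I)‖ ^ 2
        = ‖Gamma ((1 : ℝ) + t * I)‖ * ‖Gamma (1 - t * I)‖ := by
          rw [hconj, RCLike.norm_conj, sq]
      _ = ‖(t * I : ℂ)‖ * ‖Gamma (t * I) * Gamma (1 - t * I)‖ := by
          rw [hrec]
          simp only [norm_mul]
          ring
      _ = _ := by
          rw [hprod, show (Real.pi : ℂ) * (t * I) = ((Real.pi * t : ℝ) : ℂ) * I by push_cast; ring,
            sin_mul_I, ← ofReal_sinh]
          simp only [norm_mul, norm_div, norm_I, norm_real, Real.norm_eq_abs, mul_one,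
            abs_of_pos Real.pi_pos]
  have hsinh : Real.exp (Real.pi * |t|) / 4 ≤ |Real.sinh (Real.pi * t)| := by
    rw [Real.abs_sinh, abs_mul, abs_of_pos Real.pi_pos, Real.sinh_eq]
    have h1 : 1 ≤ Real.pi * |t| := by nlinarith [Real.pi_gt_three]
    have h2 : Real.exp (-(Real.pi * |t|)) ≤ 1 := Real.exp_le_one_iff.2 (by linarith)
    have h3 := Real.add_one_le_exp (Real.pi * |t|)
    linarith
  have hmain : ‖Gamma ((1 : ℝ) + t * I)‖ ^ 2
      ≤ (4 * |t| * Real.exp (-(Real.pi / 2) * |t|)) ^ 2 := by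
    rw [hsq]
    calc |t| * (Real.pi / |Real.sinh (Real.pi * t)|)
        ≤ |t| * (Real.pi / (Real.exp (Real.pi * |t|) / 4)) := by gcongr
      _ = |t| * (4 * Real.pi * Real.exp (-(Real.pi * |t|))) := by
          rw [Real.exp_neg]; field_simp
      _ ≤ |t| * (16 * |t| * Real.exp (-(Real.pi * |t|))) := by
          gcongr ?_ * (?_ * _)
          nlinarith [Real.pi_le_four]
      _ = _ := by
          rw [mul_pow, mul_pow, ← Real.exp_nat_mul]
          ring_nf
  exact (abs_le_of_sq_le_sq' hmain (by positivity)).2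

lemma norm_Gamma_natCast_add_one_le (n : ℕ) {t : ℝ} (ht : 1 ≤ |t|) :
    ‖Gamma ((n + 1 : ℝ) + t * I)‖
      ≤ 4 * (n + 1)! * |t| ^ (n + 1) * Real.exp (-(Real.pi / 2) * |t|) := by
  induction n with
  | zero => simpa using norm_Gamma_one_add_le ht
  | succ n ih =>
    have hz : (((n + 1 : ℝ) : ℂ) + t * I) ≠ 0 := fun h => by
      have := congrArg re h
      simp only [add_re, ofReal_re, mul_re, I_re, mul_zero, ofReal_im, I_im, mul_one, sub_self,
        add_zero, zero_re] at this
      linarith [(n.cast_nonneg : (0 : ℝ) ≤ n)]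
    have hrec : Gamma ((((n + 1 : ℕ) : ℝ) + 1 : ℝ) + t * I)
        = ((n + 1 : ℝ) + t * I : ℂ) * Gamma ((n + 1 : ℝ) + t * I) := by
      have := Gamma_add_one _ hz
      push_cast at this ⊢
      rw [← this]
      congr 1
      ring
    have hn : ‖((n + 1 : ℝ) + t * I : ℂ)‖ ≤ (n + 2) * |t| := by
      refine (norm_add_le _ _).trans ?_
      rw [norm_mul, norm_I, norm_real, norm_real, Real.norm_eq_abs, Real.norm_eq_abs, mul_one,
        abs_of_pos (by positivity)]
      nlinarith [(n.cast_nonneg : (0 : ℝ) ≤ n)]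
    push_cast at hrec hn ih ⊢
    rw [hrec, norm_mul]
    refine (mul_le_mul hn ih (norm_nonneg _) (by positivity)).trans (le_of_eq ?_)
    rw [Nat.factorial_succ (n + 1)]
    push_cast
    ring

/-- `Γ` decays like `e^{-π|t|/2}`, up to a power of `|t|`, in every strip `1/3 ≤ Re s ≤ n + 1`. -/
lemma exists_norm_Gamma_le (n : ℕ) :
    ∃ C : ℝ, 0 < C ∧ ∀ s : ℂ, 1 / 3 ≤ s.re → s.re ≤ n + 1 → 1 ≤ |s.im| →
      ‖Gamma s‖ ≤ C * |s.im| ^ (n + 1) * Real.exp (-(Real.pi / 2) * |s.im|) := by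
  have hc : ContinuousOn Real.Gamma (Icc (1 / 3) (n + 1)) := fun x hx =>
    (Real.differentiableAt_Gamma fun m => by
      have : (0 : ℝ) ≤ m := m.cast_nonneg
      linarith [hx.1]).continuousAt.continuousWithinAt
  obtain ⟨K, hK⟩ := isCompact_Icc.exists_bound_of_continuousOn hc
  refine ⟨4 * (|K| + 1) * (n + 1), by positivity, fun s h1 h2 h3 => ?_⟩
  have h := norm_Gamma_mul_le s.im (lt_of_lt_of_le (by norm_num) h1) h2
  rw [Real.Gamma_nat_eq_factorial, re_add_im] at h
  have hK' : Real.Gamma s.re ≤ |K| + 1 := by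
    have := (le_abs_self _).trans ((hK s.re ⟨h1, h2⟩).trans (le_abs_self K))
    linarith
  have hfac : (0 : ℝ) < n ! := by positivity
  refine le_of_mul_le_mul_right ?_ hfac
  calc ‖Gamma s‖ * n ! ≤ Real.Gamma s.re * ‖Gamma ((n + 1 : ℝ) + s.im * I)‖ := h
    _ ≤ (|K| + 1) * (4 * (n + 1)! * |s.im| ^ (n + 1)
        * Real.exp (-(Real.pi / 2) * |s.im|)) := by
        gcongr
        exact norm_Gamma_natCast_add_one_le n h3
    _ = _ := by
        rw [Nat.factorial_succ]
        push_cast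
        ring

/-! ### Growth of the Riemann zeta function -/

/-- The fractional part of `t`, cut off to `t > 1`. -/
noncomputable def fractTail : ℝ → ℂ := (Ioi (1 : ℝ)).indicator fun t => ((Int.fract t : ℝ) : ℂ)

lemma measurable_fractTail : Measurable fractTail :=
  (measurable_ofReal.comp measurable_fract).indicator measurableSet_Ioi

lemma norm_fractTail_le (t : ℝ) : ‖fractTail t‖ ≤ 1 := by
  unfold fractTail
  refine (norm_indicator_le_norm_self _ _).trans ?_
  rw [norm_real, Real.norm_eq_abs, abs_of_nonneg (Int.fract_nonneg t)]
  exact (Int.fract_lt_one t).le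

lemma mellin_fractTail (s : ℂ) :
    mellin fractTail (-s) = ∫ t in Ioi (1 : ℝ), ((Int.fract t : ℝ) : ℂ) * (t : ℂ) ^ (-(s + 1)) := by
  have : ∀ t : ℝ, (t : ℂ) ^ (-s - 1) • fractTail t
      = (Ioi (1 : ℝ)).indicator (fun t : ℝ => ((Int.fract t : ℝ) : ℂ) * (t : ℂ) ^ (-(s + 1))) t := by
    intro t
    by_cases ht : t ∈ Ioi (1 : ℝ)
    · rw [fractTail, indicator_of_mem ht, indicator_of_mem ht, smul_eq_mul, mul_comm]
      ring_nf
    · rw [fractTail, indicator_of_notMem ht, indicator_of_notMem ht, smul_zero]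
  rw [mellin, setIntegral_congr_fun measurableSet_Ioi fun t _ => this t,
    setIntegral_indicator measurableSet_Ioi,
    inter_eq_right.2 (Ioi_subset_Ioi zero_le_one)]

lemma differentiableAt_mellin_fractTail {s : ℂ} (hs : s.re < 0) :
    DifferentiableAt ℂ (mellin fractTail) s := by
  refine mellin_differentiableAt_of_isBigO_rpow (a := 0) (b := s.re - 1) ?_ ?_ hs ?_ (by linarith)
  · refine LocallyIntegrable.locallyIntegrableOn ?_ _
    refine (locallyIntegrable_const (1 : ℝ)).mono measurable_fractTail.aestronglyMeasurable ?_
    exact Eventually.of_forall fun t => by simpa using norm_fractTail_le t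
  · exact Asymptotics.isBigO_of_le atTop fun t => by simpa using norm_fractTail_le t
  · refine (Asymptotics.isBigO_zero _ _).congr' ?_ EventuallyEq.rfl
    filter_upwards [mem_nhdsWithin_of_mem_nhds (Iio_mem_nhds (zero_lt_one (α := ℝ)))] with t ht
    rw [fractTail, indicator_of_notMem (by simpa using ht.le)]

lemma norm_mellin_fractTail_le {s : ℂ} (hs : 0 < s.re) :
    ‖mellin fractTail (-s)‖ ≤ 1 / s.re := by
  rw [mellin_fractTail]
  have hint : IntegrableOn (fun t : ℝ => t ^ (-(s.re + 1))) (Ioi 1) :=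
    integrableOn_Ioi_rpow_of_lt (by linarith) one_pos
  calc _ ≤ ∫ t in Ioi (1 : ℝ), t ^ (-(s.re + 1)) := by
        refine norm_integral_le_of_norm_le hint ?_
        filter_upwards [ae_restrict_mem measurableSet_Ioi] with t ht
        have ht0 : 0 < t := one_pos.trans ht
        rw [norm_mul, norm_cpow_eq_rpow_re_of_pos ht0, norm_real, Real.norm_eq_abs,
          abs_of_nonneg (Int.fract_nonneg t)]
        simp only [neg_re, add_re, one_re]
        exact mul_le_of_le_one_left (by positivity) (Int.fract_lt_one t).le
    _ = 1 / s.re := by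
        rw [integral_Ioi_rpow_of_lt (by linarith) one_pos, Real.one_rpow]
        rw [show -(s.re + 1) + 1 = -s.re by ring, neg_div_neg_eq]

lemma riemannZeta_eq_of_one_lt_re {s : ℂ} (hs : 1 < s.re) :
    riemannZeta s = s / (s - 1) - s * mellin fractTail (-s) := by
  have hO : (fun n ↦ ∑ k ∈ Finset.Icc 1 n, ‖(1 : ℕ → ℂ) k‖) =O[atTop]
      fun n ↦ (n : ℝ) ^ (1 : ℝ) := by
    simpa using Asymptotics.isBigO_refl (fun n : ℕ => (n : ℝ)) atTop
  have h := LSeries_eq_mul_integral' 1 zero_le_one hs hO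
  rw [LSeries_one_eq_riemannZeta hs] at h
  have hi1 : IntegrableOn (fun t : ℝ => (t : ℂ) ^ (-s)) (Ioi 1) :=
    integrableOn_Ioi_cpow_of_lt (by simpa using hs) one_pos
  have hi2 : IntegrableOn (fun t : ℝ => ((Int.fract t : ℝ) : ℂ) * (t : ℂ) ^ (-(s + 1))) (Ioi 1) := by
    refine (integrableOn_Ioi_cpow_of_lt (a := -(s + 1)) (by simp; linarith) one_pos).bdd_mul
      (c := 1) (measurable_ofReal.comp measurable_fract).aestronglyMeasurable ?_
    refine Eventually.of_forall fun t => ?_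
    simp only [norm_real, Real.norm_eq_abs, abs_of_nonneg (Int.fract_nonneg t)]
    exact (Int.fract_lt_one t).le
  have h2 : ∫ t in Ioi (1 : ℝ), (∑ k ∈ Finset.Icc 1 ⌊t⌋₊, (1 : ℕ → ℂ) k) * (t : ℂ) ^ (-(s + 1))
      = (∫ t in Ioi (1 : ℝ), (t : ℂ) ^ (-s))
        - ∫ t in Ioi (1 : ℝ), ((Int.fract t : ℝ) : ℂ) * (t : ℂ) ^ (-(s + 1)) := by
    rw [← integral_sub hi1 hi2]
    refine setIntegral_congr_fun measurableSet_Ioi fun t ht => ?_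
    have ht0 : 0 < t := one_pos.trans ht
    have hfl : ((⌊t⌋₊ : ℕ) : ℝ) = t - Int.fract t := by
      rw [natCast_floor_eq_intCast_floor ht0.le, Int.self_sub_fract]
    have hfl' : ((⌊t⌋₊ : ℕ) : ℂ) = (t : ℂ) - ((Int.fract t : ℝ) : ℂ) := by
      exact_mod_cast congrArg ((↑) : ℝ → ℂ) hfl
    have hpow : (t : ℂ) ^ (-s) = t * (t : ℂ) ^ (-(s + 1)) := by
      rw [show -s = 1 + (-(s + 1)) by ring, cpow_add _ _ (ofReal_ne_zero.2 ht0.ne'), cpow_one]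
    simp only [Pi.one_apply, Finset.sum_const, Nat.card_Icc, add_tsub_cancel_right, nsmul_eq_mul,
      mul_one]
    rw [hpow, hfl']
    ring
  have hs1 : s - 1 ≠ 0 := fun h0 => by
    rw [sub_eq_zero.1 h0] at hs
    simp at hs
  rw [h, h2, integral_Ioi_cpow_of_lt (by simpa using hs) one_pos, mellin_fractTail]
  rw [ofReal_one, one_cpow, mul_sub, show -s + 1 = -(s - 1) by ring]
  field_simp

/-- Analytic continuation of `ζ(s) = s / (s - 1) - s ∫₁^∞ {t} t^(-s-1) dt` to `Re s > 0`. -/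
lemma riemannZeta₁_eq {s : ℂ} (hs : 0 < s.re) :
    riemannZeta₁ s = s - s * (s - 1) * mellin fractTail (-s) := by
  have hopen : IsOpen {s : ℂ | 0 < s.re} := isOpen_lt continuous_const continuous_re
  have hconn : IsPreconnected {s : ℂ | 0 < s.re} := (convex_halfSpace_re_gt 0).isPreconnected
  have h1 : AnalyticOnNhd ℂ riemannZeta₁ {s : ℂ | 0 < s.re} :=
    differentiable_riemannZeta₁.differentiableOn.analyticOnNhd hopen
  have h2 : AnalyticOnNhd ℂ (fun s => s - s * (s - 1) * mellin fractTail (-s))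
      {s : ℂ | 0 < s.re} := by
    refine DifferentiableOn.analyticOnNhd (fun z hz => ?_) hopen
    have : DifferentiableAt ℂ (fun s => mellin fractTail (-s)) z :=
      (differentiableAt_mellin_fractTail (s := -z) (by simpa using hz)).comp z
        differentiableAt_id.neg
    exact DifferentiableAt.differentiableWithinAt (by fun_prop)
  refine h1.eqOn_of_preconnected_of_eventuallyEq h2 hconn (z₀ := 2) (by simp) ?_ hs
  filter_upwards [(isOpen_lt continuous_const continuous_re).mem_nhds
    (show (1 : ℝ) < (2 : ℂ).re by simp)] with z hz
  have hz1 : z ≠ 1 := by rintro rfl; simp at hz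
  have := riemannZeta_eq_of_one_lt_re hz
  rw [riemannZeta_eq_inv_sub_mul hz1] at this
  have hz2 := sub_ne_zero.2 hz1
  field_simp at this
  rw [this]
  ring

lemma riemannZeta_one_half_ne_zero : riemannZeta (1 / 2) ≠ 0 := by
  have h := riemannZeta₁_eq (s := 1 / 2) (by norm_num)
  rw [riemannZeta_eq_inv_sub_mul (by norm_num)]
  refine mul_ne_zero (by norm_num) fun h0 => ?_
  -- the integral is a nonnegative real number
  have hJ : mellin fractTail (-(1 / 2)) =
      ((∫ t in Ioi (1 : ℝ), Int.fract t * t ^ (-(3 / 2) : ℝ) : ℝ) : ℂ) := by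
    rw [mellin_fractTail, ← integral_complex_ofReal]
    refine setIntegral_congr_fun measurableSet_Ioi fun t ht => ?_
    have ht0 : 0 < t := one_pos.trans ht
    rw [ofReal_mul, ofReal_cpow ht0.le]
    norm_num
  have hnn : 0 ≤ ∫ t in Ioi (1 : ℝ), Int.fract t * t ^ (-(3 / 2) : ℝ) :=
    setIntegral_nonneg measurableSet_Ioi fun t ht =>
      mul_nonneg (Int.fract_nonneg t) (Real.rpow_nonneg (one_pos.trans ht).le _)
  rw [hJ, h0] at h
  have h' := congrArg re h
  generalize (∫ t in Ioi (1 : ℝ), Int.fract t * t ^ (-(3 / 2) : ℝ)) = J at hnn h'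
  rw [show (1 / 2 - 1 / 2 * (1 / 2 - 1) * (J : ℂ) : ℂ) = ((1 / 2 + 1 / 4 * J : ℝ) : ℂ) by
    push_cast; ring, ofReal_re, zero_re] at h'
  linarith

lemma norm_riemannZeta_le_of_re {s : ℂ} (hs : 1 / 3 ≤ s.re) (ht : 1 ≤ |s.im|) :
    ‖riemannZeta s‖ ≤ 4 * ‖s‖ := by
  have hs0 : 0 < s.re := lt_of_lt_of_le (by norm_num) hs
  have hn : 1 ≤ ‖s - 1‖ := ht.trans (by simpa using abs_im_le_norm (s - 1))
  have hs1 : s - 1 ≠ 0 := norm_pos_iff.1 (one_pos.trans_le hn)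
  have hz : riemannZeta s = s / (s - 1) - s * mellin fractTail (-s) := by
    rw [riemannZeta_eq_inv_sub_mul (sub_ne_zero.1 hs1), riemannZeta₁_eq hs0]
    field_simp
  rw [hz]
  have h1 : ‖s / (s - 1)‖ ≤ ‖s‖ := by
    rw [norm_div]
    exact div_le_self (norm_nonneg _) hn
  have h2 : ‖s * mellin fractTail (-s)‖ ≤ ‖s‖ * 3 := by
    rw [norm_mul]
    gcongr
    refine (norm_mellin_fractTail_le hs0).trans ?_
    rw [div_le_iff₀ hs0]
    linarith
  linarith [norm_sub_le (s / (s - 1)) (s * mellin fractTail (-s))]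

lemma norm_cos_le (z : ℂ) : ‖cos z‖ ≤ Real.exp |z.im| := by
  rw [cos, norm_div, norm_ofNat]
  have h1 : ‖exp (z * I)‖ ≤ Real.exp |z.im| := by
    rw [norm_exp]
    simpa using neg_le_abs z.im
  have h2 : ‖exp (-z * I)‖ ≤ Real.exp |z.im| := by
    rw [norm_exp]
    simpa using le_abs_self z.im
  linarith [norm_add_le (exp (z * I)) (exp (-z * I))]

lemma norm_le_of_re_im {s : ℂ} {a : ℝ} (h1 : |s.re| ≤ a) (h : 1 ≤ |s.im|) :
    ‖s‖ ≤ (a + 1) * |s.im| := by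
  have := norm_le_abs_re_add_abs_im s
  have ha : 0 ≤ a := (abs_nonneg _).trans h1
  nlinarith

/-- Polynomial growth of `ζ` in a strip; to the left of `Re s = 1/2` by the functional equation. -/
lemma exists_norm_riemannZeta_le :
    ∃ C : ℝ, 0 < C ∧ ∀ s : ℂ, -6 ≤ s.re → s.re ≤ 10 → 1 ≤ |s.im| →
      ‖riemannZeta s‖ ≤ C * |s.im| ^ 8 := by
  obtain ⟨C, hC, hG⟩ := exists_norm_Gamma_le 6
  refine ⟨64 * C + 44, by positivity, fun s h1 h2 h3 => ?_⟩
  rcases le_or_gt (1 / 3) s.re with h4 | h4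
  · have hs : ‖s‖ ≤ (10 + 1) * |s.im| := norm_le_of_re_im (abs_le.2 ⟨by linarith, h2⟩) h3
    have h5 : |s.im| ≤ |s.im| ^ 8 := le_self_pow₀ h3 (by norm_num)
    have := norm_riemannZeta_le_of_re h4 h3
    nlinarith
  · set w : ℂ := 1 - s with hw
    have hwre : w.re = 1 - s.re := by simp [hw]
    have hwim : w.im = -s.im := by simp [hw]
    have hwabs : |w.im| = |s.im| := by rw [hwim, abs_neg]
    have hw0 : w.im ≠ 0 := fun h => by rw [← hwabs, h] at h3; norm_num at h3
    have hfe : riemannZeta s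
        = 2 * (2 * Real.pi) ^ (-w) * Gamma w * cos (Real.pi * w / 2) * riemannZeta w := by
      rw [← riemannZeta_one_sub (fun n h => hw0 (by rw [h]; simp)) (fun h => hw0 (by rw [h]; simp)),
        hw, sub_sub_cancel]
    have hp : ‖(2 * Real.pi : ℂ) ^ (-w)‖ ≤ 1 := by
      rw [show (2 * Real.pi : ℂ) = ((2 * Real.pi : ℝ) : ℂ) by push_cast; rfl,
        norm_cpow_eq_rpow_re_of_pos (by positivity)]
      exact Real.rpow_le_one_of_one_le_of_nonpos (by linarith [Real.pi_gt_three])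
        (by simp [hwre]; linarith)
    have hg := hG w (by linarith) (by norm_num; linarith) (by rwa [hwabs])
    have hc : ‖cos (Real.pi * w / 2)‖ ≤ Real.exp (Real.pi / 2 * |s.im|) := by
      refine (norm_cos_le _).trans (le_of_eq ?_)
      have : (Real.pi * w / 2 : ℂ).im = Real.pi / 2 * w.im := by
        rw [show (Real.pi * w / 2 : ℂ) = ((Real.pi / 2 : ℝ) : ℂ) * w by push_cast; ring,
          im_ofReal_mul]
      rw [this, abs_mul, abs_of_pos (by positivity), hwabs]
    have hz : ‖riemannZeta w‖ ≤ 4 * ((7 + 1) * |s.im|) := by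
      refine (norm_riemannZeta_le_of_re (by linarith) (by rwa [hwabs])).trans ?_
      rw [← hwabs]
      gcongr
      exact norm_le_of_re_im (abs_le.2 ⟨by linarith, by linarith⟩) (by rwa [hwabs])
    rw [hwabs] at hg
    rw [hfe]
    simp only [norm_mul, norm_ofNat]
    calc 2 * ‖(2 * Real.pi : ℂ) ^ (-w)‖ * ‖Gamma w‖ * ‖cos (Real.pi * w / 2)‖ * ‖riemannZeta w‖
        ≤ 2 * 1 * (C * |s.im| ^ (6 + 1) * Real.exp (-(Real.pi / 2) * |s.im|))
          * Real.exp (Real.pi / 2 * |s.im|) * (4 * ((7 + 1) * |s.im|)) := by gcongr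
      _ = 64 * C * |s.im| ^ 8 *
          (Real.exp (-(Real.pi / 2) * |s.im|) * Real.exp (Real.pi / 2 * |s.im|)) := by ring
      _ = 64 * C * |s.im| ^ 8 := by rw [← Real.exp_add]; simp
      _ ≤ _ := by gcongr; linarith

lemma one_fourth_le_norm_riemannZeta {s : ℂ} (hs : 2 ≤ s.re) : 1 / 4 ≤ ‖riemannZeta s‖ := by
  have hs1 : 1 < s.re := by linarith
  have h := zeta_eq_tsum_one_div_nat_add_one_cpow hs1
  have hsum : Summable fun n : ℕ => 1 / ((n : ℝ) + 1) ^ 2 := by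
    exact_mod_cast (summable_nat_add_iff 1).2 (Real.summable_one_div_nat_pow.2 one_lt_two)
  have hle (n : ℕ) : ‖(1 : ℂ) / (n + 1) ^ s‖ ≤ 1 / ((n : ℝ) + 1) ^ 2 := by
    rw [norm_div, norm_one, show (n + 1 : ℂ) = ((n + 1 : ℕ) : ℂ) by push_cast; rfl,
      norm_natCast_cpow_of_pos n.succ_pos]
    push_cast
    gcongr
    rw [← Real.rpow_natCast]
    exact Real.rpow_le_rpow_of_exponent_le (by linarith [(n.cast_nonneg : (0 : ℝ) ≤ n)])
      (by exact_mod_cast hs)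
  have hS : Summable fun n : ℕ => (1 : ℂ) / (n + 1) ^ s := Summable.of_norm_bounded hsum hle
  have hbasel : ∑' n : ℕ, 1 / ((n : ℝ) + 1) ^ 2 = Real.pi ^ 2 / 6 := by
    have := hasSum_zeta_two.tsum_eq
    rw [hasSum_zeta_two.summable.tsum_eq_zero_add] at this
    simpa using this
  rw [hS.tsum_eq_zero_add] at h
  rw [hsum.tsum_eq_zero_add] at hbasel
  have htail : ‖∑' n : ℕ, (1 : ℂ) / ((n + 1 : ℕ) + 1) ^ s‖ ≤ Real.pi ^ 2 / 6 - 1 := by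
    have h3 := tsum_of_norm_bounded ((summable_nat_add_iff 1).2 hsum).hasSum
      (fun n => hle (n + 1))
    norm_num at hbasel h3 ⊢
    linarith
  have hpi : Real.pi ^ 2 / 6 ≤ 7 / 4 := by nlinarith [Real.pi_lt_d2, Real.pi_pos]
  rw [h]
  have h4 := norm_sub_le_norm_add (1 : ℂ) (∑' n : ℕ, (1 : ℂ) / ((n + 1 : ℕ) + 1) ^ s)
  norm_num at h4 htail ⊢
  linarith

/-! ### Lower bounds for holomorphic functions away from their zeros -/

/-- Lower bound for a zero-free holomorphic function on a disk: Borel–Carathéodory applied to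
`log (g / g c)`. -/
lemma norm_mul_exp_le_of_ne_zero {g : ℂ → ℂ} {c : ℂ} {r L : ℝ} (hr : 0 < r) (hL : 0 < L)
    (hg : DifferentiableOn ℂ g (ball c r)) (h0 : ∀ z ∈ ball c r, g z ≠ 0)
    (hb : ∀ z ∈ ball c r, ‖g z‖ ≤ ‖g c‖ * Real.exp L) {z : ℂ} (hz : z ∈ closedBall c (4 * r / 5)) :
    ‖g c‖ * Real.exp (-(8 * L)) ≤ ‖g z‖ := by
  have hcm : c ∈ ball c r := mem_ball_self hr
  have hd : DifferentiableOn ℂ (fun z => deriv g z / g z) (ball c r) :=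
    (hg.deriv isOpen_ball).div hg h0
  obtain ⟨h, hc, hh⟩ := hd.isExactOn_ball.with_val_at c 0
  have hexp : ∀ z ∈ ball c r, g z = g c * exp (h z) := by
    intro z hz
    have hder : ∀ w ∈ ball c r, HasDerivAt (fun w => g w * exp (-h w)) 0 w := fun w hw => by
      have h1 := (hg.differentiableAt (isOpen_ball.mem_nhds hw)).hasDerivAt
      have h2 := h1.mul (hh w hw).neg.cexp
      refine h2.congr_deriv ?_
      have := h0 w hw
      field_simp
      simp
    have hconst := (convex_ball c r).is_const_of_fderivWithin_eq_zero (𝕜 := ℂ)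
      (f := fun w => g w * exp (-h w))
      (fun w hw => (hder w hw).differentiableAt.differentiableWithinAt)
      (fun w hw => by
        rw [fderivWithin_of_isOpen isOpen_ball hw]
        ext
        simp [(hder w hw).deriv]) hz hcm
    simp only [hc, neg_zero, exp_zero, mul_one] at hconst
    rw [← hconst, mul_assoc, ← exp_add, neg_add_cancel, exp_zero, mul_one]
  have hgc : 0 < ‖g c‖ := norm_pos_iff.2 (h0 c hcm)
  have hmem : ∀ w ∈ ball (0 : ℂ) r, c + w ∈ ball c r := fun w hw => by
    simpa [mem_ball, dist_eq_norm] using hw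
  have hmaps : MapsTo (fun w => h (c + w)) (ball 0 r) {z | z.re ≤ L} := fun w hw => by
    have h1 := hb _ (hmem w hw)
    rw [hexp _ (hmem w hw), norm_mul, norm_exp] at h1
    exact Real.exp_le_exp.1 (le_of_mul_le_mul_left h1 hgc)
  have hdiff : DifferentiableOn ℂ (fun w => h (c + w)) (ball 0 r) := fun w hw =>
    ((hh _ (hmem w hw)).differentiableAt.comp w
      (by fun_prop : DifferentiableAt ℂ (fun w => c + w) w)).differentiableWithinAt
  have hzn : ‖z - c‖ ≤ 4 * r / 5 := by simpa [dist_eq_norm] using hz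
  have hzb : z - c ∈ ball (0 : ℂ) r := by
    rw [mem_ball_zero_iff]
    linarith
  have hbc := borelCaratheodory_zero hL hdiff hmaps hr hzb (by simpa using hc)
  rw [add_sub_cancel] at hbc
  have h8 : ‖h z‖ ≤ 8 * L := by
    refine hbc.trans ?_
    rw [div_le_iff₀ (by linarith)]
    nlinarith
  have hzb' : z ∈ ball c r := by simpa [mem_ball, dist_eq_norm] using hzb
  rw [hexp z hzb', norm_mul, norm_exp]
  gcongr
  have := (abs_re_le_norm (h z)).trans h8
  exact neg_le_of_abs_le this

/-- Splitting off zeros in a disk one at a time: either they are exhausted or there are at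
least `n` of them. -/
lemma exists_zero_factorization {f : ℂ → ℂ} {U : Set ℂ} (hU : IsOpen U)
    (hf : DifferentiableOn ℂ f U) {K : Set ℂ} (hK : K ⊆ U) (n : ℕ) :
    ∃ (Z : Multiset ℂ) (g : ℂ → ℂ), DifferentiableOn ℂ g U ∧ (∀ ρ ∈ Z, ρ ∈ K) ∧
      (∀ s, f s = (Z.map fun ρ => s - ρ).prod * g s) ∧
      (Z.card = n ∨ ∀ s ∈ K, g s ≠ 0) := by
  induction n with
  | zero => exact ⟨0, f, hf, by simp, by simp, Or.inl rfl⟩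
  | succ n ih =>
    obtain ⟨Z, g, hg, hZ, hfac, hcard⟩ := ih
    by_cases hz : ∀ s ∈ K, g s ≠ 0
    · exact ⟨Z, g, hg, hZ, hfac, Or.inr hz⟩
    · push Not at hz
      obtain ⟨ρ, hρ, hg0⟩ := hz
      have hcard' := hcard.resolve_right fun h => h ρ hρ hg0
      refine ⟨ρ ::ₘ Z, dslope g ρ, (differentiableOn_dslope (hU.mem_nhds (hK hρ))).2 hg, ?_, ?_,
        Or.inl (by simp [hcard'])⟩
      · simpa using ⟨hρ, hZ⟩
      · intro s
        have := sub_smul_dslope_of_zero hg0 s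
        rw [hfac s, Multiset.map_cons, Multiset.prod_cons, ← this, smul_eq_mul]
        ring

lemma prod_norm_sub_le {Z : Multiset ℂ} {s : ℂ} {a : ℝ} (h : ∀ ρ ∈ Z, ‖s - ρ‖ ≤ a) :
    ‖(Z.map fun ρ => s - ρ).prod‖ ≤ a ^ Z.card := by
  induction Z using Multiset.induction with
  | empty => simp
  | cons ρ Z ih =>
    rw [Multiset.map_cons, Multiset.prod_cons, norm_mul, Multiset.card_cons, pow_succ']
    have h1 := h ρ (by simp)
    have h2 := ih fun ρ' h' => h ρ' (by simp [h'])
    exact mul_le_mul h1 h2 (norm_nonneg _) ((norm_nonneg _).trans h1)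

lemma pow_card_le_prod_norm_sub {Z : Multiset ℂ} {s : ℂ} {a : ℝ} (ha : 0 ≤ a)
    (h : ∀ ρ ∈ Z, a ≤ ‖s - ρ‖) : a ^ Z.card ≤ ‖(Z.map fun ρ => s - ρ).prod‖ := by
  induction Z using Multiset.induction with
  | empty => simp
  | cons ρ Z ih =>
    rw [Multiset.map_cons, Multiset.prod_cons, norm_mul, Multiset.card_cons, pow_succ']
    exact mul_le_mul (h ρ (by simp)) (ih fun ρ' h' => h ρ' (by simp [h']))
      (by positivity) (norm_nonneg _)

/-- If the zeros in `Z` are split off from `f`, the cofactor satisfies the bound of `f` with a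
factor `2 ^ Z.card` to spare: on the circle of radius `3r` each `s - ρ` is at least twice its
largest possible value at the centre. -/
lemma norm_cofactor_le {f g : ℂ → ℂ} {U : Set ℂ} {c : ℂ} {r L : ℝ} (hr : 0 < r)
    (hg : DifferentiableOn ℂ g U) (hKU : closedBall c (3 * r) ⊆ U) {Z : Multiset ℂ}
    (hZ : ∀ ρ ∈ Z, ρ ∈ closedBall c r) (hfac : ∀ s, f s = (Z.map fun ρ => s - ρ).prod * g s)
    (hb : ∀ s ∈ closedBall c (3 * r), ‖f s‖ ≤ ‖f c‖ * Real.exp L) {s : ℂ}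
    (hs : s ∈ closedBall c (3 * r)) : ‖g s‖ * 2 ^ Z.card ≤ ‖g c‖ * Real.exp L := by
  have hfc : ‖f c‖ ≤ r ^ Z.card * ‖g c‖ := by
    rw [hfac c, norm_mul]
    gcongr
    refine prod_norm_sub_le fun ρ hρ => ?_
    rw [norm_sub_rev]
    simpa [dist_eq_norm] using hZ ρ hρ
  have hcl : closure (ball c (3 * r)) = closedBall c (3 * r) := closure_ball c (by positivity)
  have hd : DiffContOnCl ℂ g (ball c (3 * r)) :=
    DifferentiableOn.diffContOnCl (hcl.symm ▸ hg.mono hKU)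
  have := norm_le_of_forall_mem_frontier_norm_le (C := ‖g c‖ * Real.exp L / 2 ^ Z.card)
    isBounded_ball hd (fun w hw => ?_) (hcl ▸ hs)
  · rwa [le_div_iff₀ (by positivity)] at this
  · rw [frontier_ball c (by positivity : (3 * r) ≠ 0), mem_sphere, dist_eq_norm] at hw
    have h1 : (2 * r) ^ Z.card ≤ ‖(Z.map fun ρ => w - ρ).prod‖ := by
      refine pow_card_le_prod_norm_sub (by positivity) fun ρ hρ => ?_
      have h2 : ‖ρ - c‖ ≤ r := by simpa [dist_eq_norm] using hZ ρ hρ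
      have h3 := norm_sub_norm_le (w - c) (ρ - c)
      rw [sub_sub_sub_cancel_right] at h3
      linarith
    have h4 := hb w (by simp [dist_eq_norm, hw])
    rw [hfac w, norm_mul] at h4
    rw [le_div_iff₀ (by positivity)]
    have h5 : (2 * r) ^ Z.card * ‖g w‖ ≤ r ^ Z.card * ‖g c‖ * Real.exp L :=
      (mul_le_mul_of_nonneg_right h1 (norm_nonneg _)).trans (h4.trans (by gcongr))
    rw [mul_pow] at h5
    refine le_of_mul_le_mul_left (a := r ^ Z.card) ?_ (by positivity)
    linarith

/-- A function that is at most `e^L |f c|` on the disk of radius `3r` about `c` has at most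
`L / log 2` zeros in the disk of radius `r`, and is not small away from them in a slightly smaller
disk. -/
lemma exists_zeros_and_lower_bound {f : ℂ → ℂ} {U : Set ℂ} {c : ℂ} {r L : ℝ} (hr : 0 < r)
    (hL : 0 < L) (hU : IsOpen U) (hf : DifferentiableOn ℂ f U) (hKU : closedBall c (3 * r) ⊆ U)
    (hc : f c ≠ 0) (hb : ∀ s ∈ closedBall c (3 * r), ‖f s‖ ≤ ‖f c‖ * Real.exp L) :
    ∃ Z : Finset ℂ, (Z.card : ℝ) ≤ L / Real.log 2 ∧ (∀ ρ ∈ Z, f ρ = 0) ∧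
      (∀ ρ ∈ closedBall c r, f ρ = 0 → ρ ∈ Z) ∧
      ∀ s ∈ closedBall c (4 * r / 5), ∀ d : ℝ, 0 < d → d ≤ r → (∀ ρ ∈ Z, d ≤ ‖s - ρ‖) →
        ‖f c‖ * Real.exp (-(8 * L)) * (d / r) ^ (L / Real.log 2) ≤ ‖f s‖ := by
  have hsub : closedBall c r ⊆ closedBall c (3 * r) := closedBall_subset_closedBall (by linarith)
  have hlog2 : 0 < Real.log 2 := Real.log_pos one_lt_two
  have hcc : c ∈ closedBall c (3 * r) := mem_closedBall_self (by positivity)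
  have hgc {Z : Multiset ℂ} {g : ℂ → ℂ} (hfac : ∀ s, f s = (Z.map fun ρ => s - ρ).prod * g s) :
      0 < ‖g c‖ := norm_pos_iff.2 fun h => hc (by rw [hfac c, h, mul_zero])
  have hcount {Z : Multiset ℂ} {g : ℂ → ℂ} (hg : DifferentiableOn ℂ g U)
      (hZ : ∀ ρ ∈ Z, ρ ∈ closedBall c r) (hfac : ∀ s, f s = (Z.map fun ρ => s - ρ).prod * g s) :
      (Z.card : ℝ) ≤ L / Real.log 2 := by
    have h1 := norm_cofactor_le hr hg hKU hZ hfac hb hcc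
    have h2 := le_of_mul_le_mul_left h1 (hgc hfac)
    rw [le_div_iff₀ hlog2, ← Real.log_pow]
    exact (Real.log_le_iff_le_exp (by positivity)).2 h2
  obtain ⟨Z, g, hg, hZ, hfac, hcard⟩ :=
    exists_zero_factorization hU hf (hsub.trans hKU) (⌊L / Real.log 2⌋₊ + 1)
  have hN := hcount hg hZ hfac
  have hg0 : ∀ s ∈ closedBall c r, g s ≠ 0 := by
    refine hcard.resolve_left fun h => ?_
    rw [h] at hN
    push_cast at hN
    exact absurd (Nat.lt_floor_add_one (L / Real.log 2)) (not_lt.2 hN)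
  refine ⟨Z.toFinset, ?_, fun ρ hρ => ?_, fun ρ hρ h0 => ?_, fun s hs d hd hdr hdist => ?_⟩
  · exact (Nat.cast_le.2 Z.toFinset_card_le).trans hN
  · rw [hfac ρ, Multiset.prod_eq_zero, zero_mul]
    exact Multiset.mem_map.2 ⟨ρ, Multiset.mem_toFinset.1 hρ, sub_self ρ⟩
  · rw [hfac ρ] at h0
    have h1 := (mul_eq_zero.1 h0).resolve_right (hg0 ρ hρ)
    obtain ⟨ρ', h2, h3⟩ := Multiset.mem_map.1 (Multiset.prod_eq_zero_iff.1 h1)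
    rw [Multiset.mem_toFinset, sub_eq_zero.1 h3]
    exact h2
  · have hbr : ball c r ⊆ closedBall c r := ball_subset_closedBall
    have hlow := norm_mul_exp_le_of_ne_zero hr hL (hg.mono (hbr.trans (hsub.trans hKU)))
      (fun z hz => hg0 z (hbr hz)) (fun z hz => by
        have h1 := norm_cofactor_le hr hg hKU hZ hfac hb (hsub (hbr hz))
        exact (le_mul_of_one_le_right (norm_nonneg _) (one_le_pow₀ one_le_two)).trans h1) hs
    have hfc : ‖f c‖ ≤ r ^ Z.card * ‖g c‖ := by
      rw [hfac c, norm_mul]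
      gcongr
      refine prod_norm_sub_le fun ρ hρ => ?_
      rw [norm_sub_rev]
      simpa [dist_eq_norm] using hZ ρ hρ
    have hprod : d ^ Z.card ≤ ‖(Z.map fun ρ => s - ρ).prod‖ :=
      pow_card_le_prod_norm_sub hd.le fun ρ hρ => hdist ρ (Multiset.mem_toFinset.2 hρ)
    have hpow : (d / r) ^ (L / Real.log 2) ≤ (d / r) ^ Z.card := by
      rw [← Real.rpow_natCast]
      exact Real.rpow_le_rpow_of_exponent_ge (by positivity) ((div_le_one hr).2 hdr) hN
    calc ‖f c‖ * Real.exp (-(8 * L)) * (d / r) ^ (L / Real.log 2)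
        ≤ r ^ Z.card * ‖g c‖ * Real.exp (-(8 * L)) * (d / r) ^ Z.card := by gcongr
      _ = d ^ Z.card * (‖g c‖ * Real.exp (-(8 * L))) := by
          rw [div_pow]
          field_simp
      _ ≤ ‖(Z.map fun ρ => s - ρ).prod‖ * ‖g s‖ := by gcongr
      _ = ‖f s‖ := by rw [hfac s, norm_mul]

/-! ### Zeros of zeta and lower bounds for zeta at height `t` -/

lemma exists_zeta_zeros_and_lower_bound :
    ∃ t₀ : ℝ, 10 ≤ t₀ ∧ ∀ τ : ℝ, t₀ ≤ |τ| →
      ∃ Z : Finset ℂ, (Z.card : ℝ) ≤ 9 * Real.log |τ| / Real.log 2 ∧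
        (∀ ρ ∈ Z, riemannZeta ρ = 0) ∧
        (∀ ρ ∈ closedBall (2 + τ * I : ℂ) (5 / 2), riemannZeta ρ = 0 → ρ ∈ Z) ∧
        ∀ s ∈ closedBall (2 + τ * I : ℂ) 2, ∀ d : ℝ, 0 < d → d ≤ 5 / 2 →
          (∀ ρ ∈ Z, d ≤ ‖s - ρ‖) →
          1 / 4 * Real.exp (-(8 * (9 * Real.log |τ|))) *
            (d / (5 / 2)) ^ (9 * Real.log |τ| / Real.log 2) ≤ ‖riemannZeta s‖ := by
  obtain ⟨C, hC, hgrow⟩ := exists_norm_riemannZeta_le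
  refine ⟨max 10 (1024 * C), le_max_left _ _, fun τ hτ => ?_⟩
  have h10 : 10 ≤ |τ| := (le_max_left _ _).trans hτ
  have hCτ : 1024 * C ≤ |τ| := (le_max_right _ _).trans hτ
  have hτ0 : 0 < |τ| := by linarith
  have hcre : (2 + τ * I : ℂ).re = 2 := by simp
  have hcim : (2 + τ * I : ℂ).im = τ := by simp
  have hbox : ∀ s ∈ closedBall (2 + τ * I : ℂ) (3 * (5 / 2)),
      |s.re - 2| ≤ 15 / 2 ∧ |s.im - τ| ≤ 15 / 2 := fun s hs => by
    have h1 : ‖s - (2 + τ * I)‖ ≤ 3 * (5 / 2) := by simpa [dist_eq_norm] using hs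
    have h2 := abs_re_le_norm (s - (2 + τ * I))
    have h3 := abs_im_le_norm (s - (2 + τ * I))
    rw [sub_re, hcre] at h2
    rw [sub_im, hcim] at h3
    constructor <;> linarith
  have him : ∀ s ∈ closedBall (2 + τ * I : ℂ) (3 * (5 / 2)),
      1 ≤ |s.im| ∧ |s.im| ≤ 2 * |τ| := fun s hs => by
    have h1 := (hbox s hs).2
    have h2 := abs_sub_abs_le_abs_sub s.im τ
    have h3 := abs_sub_abs_le_abs_sub τ s.im
    rw [abs_sub_comm] at h3
    constructor <;> linarith
  have hc4 : 1 / 4 ≤ ‖riemannZeta (2 + τ * I)‖ := one_fourth_le_norm_riemannZeta (by simp)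
  have hsub : closedBall (2 + τ * I : ℂ) (3 * (5 / 2)) ⊆ {1}ᶜ := fun s hs h => by
    have h1 := (him s hs).1
    rw [mem_singleton_iff.1 h] at h1
    norm_num at h1
  have hlog : 0 < Real.log |τ| := Real.log_pos (by linarith)
  have hexp : Real.exp (9 * Real.log |τ|) = |τ| ^ 9 := by
    rw [mul_comm, Real.exp_mul, Real.exp_log hτ0]
    norm_cast
  obtain ⟨Z, h1, h2, h3, h4⟩ := exists_zeros_and_lower_bound (f := riemannZeta) (U := {1}ᶜ)
    (c := 2 + τ * I) (r := 5 / 2) (L := 9 * Real.log |τ|) (by norm_num) (by positivity)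
    isOpen_compl_singleton differentiableOn_riemannZeta hsub
    (norm_pos_iff.1 (by linarith)) fun s hs => by
      obtain ⟨hr1, hr2⟩ := abs_le.1 (hbox s hs).1
      rw [hexp]
      calc ‖riemannZeta s‖ ≤ C * |s.im| ^ 8 :=
            hgrow s (by linarith) (by linarith) (him s hs).1
        _ ≤ C * (2 * |τ|) ^ 8 := by gcongr; exact (him s hs).2
        _ = 1 / 4 * ((1024 * C) * |τ| ^ 8) := by ring
        _ ≤ 1 / 4 * (|τ| * |τ| ^ 8) := by gcongr
        _ = 1 / 4 * |τ| ^ 9 := by ring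
        _ ≤ _ := by gcongr
  refine ⟨Z, h1, h2, h3, fun s hs d hd hd' hdist => le_trans ?_ (h4 s ?_ d hd hd' hdist)⟩
  · gcongr
  · convert hs using 2
    norm_num

/-- The lower bound for `ζ` at distance `1 / (A log t)` from its zeros is of size
`exp (-O((log t)²))`. -/
lemma eventually_exp_neg_le {A : ℝ} (hA : 0 < A) :
    ∀ᶠ t : ℝ in atTop, Real.exp (-(t / 4)) ≤
      1 / 4 * Real.exp (-(8 * (9 * Real.log t))) *
        (1 / (A * Real.log t) / (5 / 2)) ^ (9 * Real.log t / Real.log 2) := by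
  have hlog2 : 0 < Real.log 2 := Real.log_pos one_lt_two
  set K : ℝ := 2 + 72 + 9 / Real.log 2 * (5 / 2 * A) with hK
  have hK0 : 0 < K := by positivity
  have ho := (Real.isLittleO_pow_log_id_atTop (n := 2)).bound
    (show (0 : ℝ) < 1 / (4 * K) by positivity)
  filter_upwards [ho, Real.tendsto_log_atTop.eventually_ge_atTop 1, eventually_gt_atTop 0]
    with t ht h1 h0
  have hℓ : 0 < Real.log t := by linarith
  rw [Real.norm_eq_abs, abs_of_nonneg (by positivity), id, Real.norm_eq_abs, abs_of_pos h0] at ht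
  have hb : 1 / (A * Real.log t) / (5 / 2) = (5 / 2 * (A * Real.log t))⁻¹ := by
    field_simp
  rw [hb, Real.inv_rpow (by positivity), Real.rpow_def_of_pos (by positivity), ← Real.exp_neg]
  have h4 : Real.exp (-2) ≤ 1 / 4 := by
    rw [Real.exp_neg, one_div]
    refine inv_anti₀ (by norm_num) ?_
    have := Real.add_one_le_exp 1
    rw [show (2 : ℝ) = 1 + 1 by norm_num, Real.exp_add]
    nlinarith
  refine le_trans ?_ (mul_le_mul_of_nonneg_right (mul_le_mul_of_nonneg_right h4
    (Real.exp_pos _).le) (Real.exp_pos _).le)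
  rw [← Real.exp_add, ← Real.exp_add]
  refine Real.exp_le_exp.2 ?_
  have hl : Real.log (5 / 2 * (A * Real.log t)) ≤ 5 / 2 * A * Real.log t := by
    have := Real.log_le_sub_one_of_pos (show 0 < 5 / 2 * (A * Real.log t) by positivity)
    linarith
  have h5 : Real.log (5 / 2 * (A * Real.log t)) * (9 * Real.log t / Real.log 2)
      ≤ 9 / Real.log 2 * (5 / 2 * A) * Real.log t ^ 2 := by
    calc _ ≤ 5 / 2 * A * Real.log t * (9 * Real.log t / Real.log 2) := by gcongr
      _ = _ := by ring
  have h6 : K * Real.log t ^ 2 ≤ t / 4 := by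
    calc K * Real.log t ^ 2 ≤ K * (1 / (4 * K) * t) := by gcongr
      _ = t / 4 := by field_simp
  rw [hK] at h6
  nlinarith

/-- Under RH, `1 / |ζ|` grows more slowly than `exp (|t| / 4)` away from the zeros. -/
lemma exists_exp_neg_le_norm_riemannZeta (hRH : RiemannHypothesis) {A : ℝ} (hA : 0 < A) :
    ∃ t₀ : ℝ, ∀ s : ℂ, 1 / 3 ≤ s.re → t₀ ≤ |s.im| →
      (∀ ρ : ℂ, riemannZeta ρ = 0 → ρ.re = 1 / 2 → 1 / (A * Real.log |s.im|) ≤ ‖s - ρ‖) →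
      Real.exp (-(|s.im| / 4)) ≤ ‖riemannZeta s‖ := by
  obtain ⟨t₀, ht₀, hZ⟩ := exists_zeta_zeros_and_lower_bound
  obtain ⟨t₁, h1⟩ := ((eventually_exp_neg_le hA).and
    ((Real.tendsto_log_atTop.eventually_ge_atTop (1 / A)).and
      (Real.tendsto_log_atTop.eventually_gt_atTop 0))).exists_forall_of_atTop
  refine ⟨max t₀ t₁, fun s hs ht hdist => ?_⟩
  obtain ⟨hexp, hAl, hlog⟩ := h1 |s.im| ((le_max_right _ _).trans ht)
  have ht' := (le_max_left _ _).trans ht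
  rcases le_or_gt 2 s.re with h2 | h2
  · refine le_trans ?_ (one_fourth_le_norm_riemannZeta h2)
    rw [Real.exp_neg, one_div]
    refine inv_anti₀ (by norm_num) ?_
    have h3 := Real.quadratic_le_exp_of_nonneg (show 0 ≤ |s.im| / 4 by positivity)
    nlinarith
  · obtain ⟨Z, -, hz, -, hlow⟩ := hZ s.im ht'
    have hd1 : 1 / (A * Real.log |s.im|) ≤ 1 := by
      rw [div_le_one (by positivity)]
      rwa [div_le_iff₀' hA] at hAl
    refine hexp.trans (hlow s ?_ _ (by positivity) (by linarith) fun ρ hρ => ?_)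
    · have : s - (2 + s.im * I) = ((s.re - 2 : ℝ) : ℂ) := by
        apply Complex.ext <;> simp
      rw [mem_closedBall, dist_eq_norm, this, norm_real, Real.norm_eq_abs, abs_le]
      constructor <;> linarith
    · by_cases htriv : ∃ n : ℕ, ρ = -2 * (n + 1)
      · obtain ⟨n, rfl⟩ := htriv
        have h3 := abs_im_le_norm (s - -2 * (n + 1))
        have h4 : (s - -2 * (n + 1) : ℂ).im = s.im := by simp
        rw [h4] at h3
        linarith
      · have hne : ρ ≠ 1 := fun h => riemannZeta_one_ne_zero (h ▸ hz ρ hρ)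
        exact hdist ρ (hz ρ hρ) (hRH ρ (hz ρ hρ) htriv hne)

/-! ### Decay of `H` -/

lemma kappa_div_zetaTwo_pos : 0 < kappa / zetaTwo := by
  unfold kappa zetaTwo
  positivity

lemma norm_eta_le {s : ℂ} (hs : 1 / 3 ≤ s.re) (ht : 1 ≤ |s.im|) :
    ‖eta s‖ ≤ (kappa / zetaTwo) ^ s.re * 2 * (4 * ‖s + 1‖) := by
  unfold eta
  rw [norm_mul, norm_mul, norm_cpow_eq_rpow_re_of_pos kappa_div_zetaTwo_pos]
  have h2 : ‖(2 : ℂ) ^ (-s - 1)‖ ≤ 1 := by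
    rw [show (2 : ℂ) = ((2 : ℝ) : ℂ) by simp, norm_cpow_eq_rpow_re_of_pos two_pos]
    exact Real.rpow_le_one_of_one_le_of_nonpos one_le_two (by simp; linarith)
  have h3 : ‖1 - (2 : ℂ) ^ (-s - 1)‖ ≤ 2 := by
    refine (norm_sub_le _ _).trans ?_
    rw [norm_one]
    linarith
  have := kappa_div_zetaTwo_pos
  gcongr
  exact norm_riemannZeta_le_of_re (by simp; linarith) (by simpa using ht)

/-- Under RH, `H` is at most `exp (-|t|)` in vertical strips, away from the zeros of `ζ`. -/
lemma exists_norm_H_le (hRH : RiemannHypothesis) {A : ℝ} (hA : 0 < A) (σ : ℝ) :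
    ∃ t₀ : ℝ, 2 ≤ t₀ ∧ ∀ s : ℂ, 1 / 3 ≤ s.re → s.re ≤ σ → t₀ ≤ |s.im| →
      (∀ ρ : ℂ, riemannZeta ρ = 0 → ρ.re = 1 / 2 → 1 / (A * Real.log |s.im|) ≤ ‖s - ρ‖) →
      ‖H s‖ ≤ Real.exp (-|s.im|) := by
  obtain ⟨t₁, h1⟩ := exists_exp_neg_le_norm_riemannZeta hRH hA
  obtain ⟨C, hC, hG⟩ := exists_norm_Gamma_le ⌈σ⌉₊
  set n := ⌈σ⌉₊
  set q : ℝ := kappa / zetaTwo + 1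
  have hq : 1 ≤ q := by linarith [kappa_div_zetaTwo_pos]
  set M : ℝ := q ^ |σ| * 2 * (4 * ((|σ| + 1) + 1)) * (8 * (|σ| + 1)) * C
  have hM : 0 < M := by positivity
  have ho := (isLittleO_pow_exp_pos_mul_atTop (n + 3) (show (0 : ℝ) < 3 / 10 by norm_num)).bound
    (show 0 < 1 / M by positivity)
  obtain ⟨t₂, h2⟩ := ho.exists_forall_of_atTop
  refine ⟨max 2 (max t₁ t₂), le_max_left _ _, fun s hs hσ ht hdist => ?_⟩
  have ht2 : 2 ≤ |s.im| := (le_max_left _ _).trans ht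
  have ht1 : 1 ≤ |s.im| := by linarith
  have htt := (le_max_right _ _).trans ht
  have hz := h1 s hs ((le_max_left _ _).trans htt) hdist
  have hpe := h2 |s.im| ((le_max_right _ _).trans htt)
  rw [Real.norm_eq_abs, Real.norm_eq_abs, abs_of_nonneg (by positivity), Real.abs_exp,
    div_mul_eq_mul_div, one_mul, le_div_iff₀' hM] at hpe
  have hσ0 : 0 < σ := by linarith
  have hσabs : |σ| = σ := abs_of_pos hσ0
  have hre : |s.re| ≤ |σ| := by
    rw [hσabs, abs_of_pos (by linarith)]
    exact hσ
  have heta : ‖eta s‖ ≤ q ^ |σ| * 2 * (4 * ((|σ| + 1) + 1) * |s.im|) := by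
    refine (norm_eta_le hs ht1).trans ?_
    have hκ := kappa_div_zetaTwo_pos
    rw [mul_assoc 4]
    gcongr ?_ * 2 * (4 * ?_)
    · calc (kappa / zetaTwo) ^ s.re ≤ q ^ s.re :=
            Real.rpow_le_rpow hκ.le (by simp [q]) (by linarith)
        _ ≤ q ^ |σ| := Real.rpow_le_rpow_of_exponent_le hq ((le_abs_self _).trans hre)
    · have := norm_le_of_re_im (s := s + 1) (a := |σ| + 1)
        (by simpa using (abs_add_le s.re 1).trans (by simpa using hre)) (by simpa using ht1)
      simpa using this
  have hz2 : ‖riemannZeta (2 * s)‖ ≤ 8 * (|σ| + 1) * |s.im| := by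
    have him : (2 * s).im = 2 * s.im := by simp
    have hre2 : (2 * s).re = 2 * s.re := by simp
    refine (norm_riemannZeta_le_of_re (by rw [hre2]; linarith)
      (by rw [him, abs_mul, abs_two]; linarith)).trans ?_
    have h5 := norm_le_of_re_im hre ht1
    rw [norm_mul, norm_ofNat]
    linarith
  have hg := hG s hs (by linarith [show σ ≤ (n : ℝ) from Nat.le_ceil σ]) ht1
  have hinv : ‖riemannZeta s‖⁻¹ ≤ Real.exp (|s.im| / 4) := by
    rw [← neg_neg (|s.im| / 4), Real.exp_neg (-(|s.im| / 4))]
    exact inv_anti₀ (Real.exp_pos _) hz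
  unfold H
  rw [norm_mul, norm_mul, norm_div, div_eq_mul_inv]
  calc ‖eta s‖ * (‖riemannZeta (2 * s)‖ * ‖riemannZeta s‖⁻¹) * ‖Gamma s‖
      ≤ (q ^ |σ| * 2 * (4 * ((|σ| + 1) + 1) * |s.im|)) *
        ((8 * (|σ| + 1) * |s.im|) * Real.exp (|s.im| / 4)) *
        (C * |s.im| ^ (n + 1) * Real.exp (-(Real.pi / 2) * |s.im|)) := by gcongr
    _ = (M * |s.im| ^ (n + 3)) *
        (Real.exp (|s.im| / 4) * Real.exp (-(Real.pi / 2) * |s.im|)) := by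
        simp only [M]
        ring
    _ ≤ Real.exp (3 / 10 * |s.im|) *
        (Real.exp (|s.im| / 4) * Real.exp (-(Real.pi / 2) * |s.im|)) := by gcongr
    _ ≤ Real.exp (-|s.im|) := by
        rw [← Real.exp_add, ← Real.exp_add]
        refine Real.exp_le_exp.2 ?_
        nlinarith [Real.pi_gt_d2]

/-! ### Residues of simple poles on circles and rectangles -/

/-- Removable singularities: if `(s - p) f(s) → 0`, then `f` is differentiable at `p` once its
value there is replaced by the limit. -/
lemma differentiableAt_update_limUnder {f : ℂ → ℂ} {p : ℂ}
    (hd : ∀ᶠ s in 𝓝[≠] p, DifferentiableAt ℂ f s)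
    (h0 : Tendsto (fun s => (s - p) * f s) (𝓝[≠] p) (𝓝 0)) :
    DifferentiableAt ℂ (Function.update f p (limUnder (𝓝[≠] p) f)) p := by
  have hmem : {s | s ≠ p → DifferentiableAt ℂ f s} ∈ 𝓝 p := eventually_nhdsWithin_iff.1 hd
  refine (differentiableOn_update_limUnder_of_isLittleO hmem
    (fun s hs => (hs.1 hs.2).differentiableWithinAt) ?_).differentiableAt hmem
  have hne : ∀ᶠ s in 𝓝[≠] p, (s - p)⁻¹ = 0 → f s - f p = 0 := by
    filter_upwards [self_mem_nhdsWithin] with s hs h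
    exact absurd h (inv_ne_zero (sub_ne_zero.2 hs))
  refine (Asymptotics.isLittleO_iff_tendsto' hne).2 ?_
  have h1 : Tendsto (fun s => (s - p) * f p) (𝓝[≠] p) (𝓝 0) := by
    have : Tendsto (fun s => (s - p) * f p) (𝓝 p) (𝓝 ((p - p) * f p)) :=
      (Continuous.tendsto (by fun_prop) p)
    rw [sub_self, zero_mul] at this
    exact this.mono_left nhdsWithin_le_nhds
  have h2 := h0.sub h1
  rw [sub_zero] at h2
  refine h2.congr fun s => ?_
  rw [div_inv_eq_mul]
  ring

/-- At a simple pole the residue is the limit of `(s - p) f(s)`. -/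
lemma residue_eq_of_tendsto {f : ℂ → ℂ} {p c : ℂ}
    (hd : ∀ᶠ s in 𝓝[≠] p, DifferentiableAt ℂ f s)
    (hc : Tendsto (fun s => (s - p) * f s) (𝓝[≠] p) (𝓝 c)) : residue f p = c := by
  unfold residue
  refine Tendsto.limUnder_eq ?_
  set g : ℂ → ℂ := Function.update (fun s => (s - p) * f s) p c with hg
  have hgp : g p = c := Function.update_self ..
  have hcont : ContinuousAt g p := continuousAt_update_same.2 hc
  have hgd : ∀ᶠ s in 𝓝[≠] p, DifferentiableAt ℂ g s := by
    filter_upwards [hd, self_mem_nhdsWithin] with s hs hne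
    have : g =ᶠ[𝓝 s] fun s => (s - p) * f s := by
      filter_upwards [isOpen_ne.mem_nhds hne] with w hw
      exact Function.update_of_ne hw ..
    exact this.differentiableAt_iff.2 (by fun_prop)
  obtain ⟨R, hR, hball⟩ := Metric.mem_nhdsWithin_iff.1 hgd
  refine tendsto_const_nhds.congr' ?_
  filter_upwards [Ioo_mem_nhdsGT hR] with r hr
  have hcl : closedBall p r ⊆ ball p R := closedBall_subset_ball hr.2
  have hdiff : ∀ z ∈ closedBall p r \ {p}, DifferentiableAt ℂ g z := fun z hz =>
    hball ⟨hcl hz.1, hz.2⟩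
  have hco : ContinuousOn g (closedBall p r) := fun z hz => by
    rcases eq_or_ne z p with rfl | hne
    · exact hcont.continuousWithinAt
    · exact (hdiff z ⟨hz, hne⟩).continuousAt.continuousWithinAt
  have hint := circleIntegral_sub_inv_smul_of_differentiable_on_off_countable
    (countable_singleton p) (mem_ball_self hr.1) hco
    fun z hz => hdiff z ⟨ball_subset_closedBall hz.1, hz.2⟩
  have hcongr : ∮ z in C(p, r), f z = ∮ z in C(p, r), (z - p)⁻¹ • g z := by
    refine circleIntegral.integral_congr hr.1.le fun z hz => ?_
    have hne : z ≠ p := ne_of_mem_sphere hz hr.1.ne'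
    have h1 := sub_ne_zero.2 hne
    simp only [hg, Function.update_of_ne hne, smul_eq_mul]
    field_simp
  have h2 : (2 * (Real.pi : ℂ) * I) ≠ 0 := two_pi_I_ne_zero
  rw [hcongr, hint, hgp, smul_eq_mul, ← mul_assoc, inv_mul_cancel₀ h2, one_mul]

/-- The integral of `f` over the boundary of the rectangle `[a, b] × [c, d]`, counterclockwise. -/
noncomputable def rectIntegral (f : ℂ → ℂ) (a b c d : ℝ) : ℂ :=
  (∫ x : ℝ in a..b, f (x + c * I)) - (∫ x : ℝ in a..b, f (x + d * I)) +
    I • (∫ y : ℝ in c..d, f (b + y * I)) - I • (∫ y : ℝ in c..d, f (a + y * I))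

lemma rectIntegral_eq_zero {f : ℂ → ℂ} {a b c d : ℝ}
    (h : DifferentiableOn ℂ f (uIcc a b ×ℂ uIcc c d)) : rectIntegral f a b c d = 0 := by
  simpa [rectIntegral] using
    integral_boundary_rect_eq_zero_of_differentiableOn f (a + c * I) (b + d * I) (by simpa using h)

/-- The four sides are integrated with `log (s - p)` on all sides but the left one, and with
`log (p - s)` on the left one, so that the branch cut is never met. -/
lemma rectIntegral_inv_sub {a b c d : ℝ} {p : ℂ} (ha : a < p.re) (hb : p.re < b) (hc : c < p.im)
    (hd : p.im < d) : rectIntegral (fun s => (s - p)⁻¹) a b c d = 2 * Real.pi * I := by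
  have hhor (y x : ℝ) (h : (x + y * I - p : ℂ) ∈ slitPlane) :
      HasDerivAt (fun x : ℝ => log (x + y * I - p)) ((x + y * I - p : ℂ)⁻¹) x := by
    have h1 : HasDerivAt (fun x : ℝ => (x + y * I - p : ℂ)) 1 x :=
      ((hasDerivAt_id x).ofReal_comp.add_const (y * I : ℂ)).sub_const p
    simpa using h1.clog_real h
  have hver (x y : ℝ) (h : (x + y * I - p : ℂ) ∈ slitPlane) :
      HasDerivAt (fun y : ℝ => log (x + y * I - p)) (I * (x + y * I - p : ℂ)⁻¹) y := by
    have h1 : HasDerivAt (fun y : ℝ => (x + y * I - p : ℂ)) I y := by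
      simpa using
        (((hasDerivAt_id y).ofReal_comp.mul_const I).const_add (x : ℂ)).sub_const p
    simpa [div_eq_mul_inv] using h1.clog_real h
  have hver' (x y : ℝ) (h : -(x + y * I - p : ℂ) ∈ slitPlane) :
      HasDerivAt (fun y : ℝ => log (-(x + y * I - p))) (I * (x + y * I - p : ℂ)⁻¹) y := by
    have h1 : HasDerivAt (fun y : ℝ => -(x + y * I - p : ℂ)) (-I) y := by
      have := ((((hasDerivAt_id y).ofReal_comp.mul_const I).const_add (x : ℂ)).sub_const p).fun_neg
      rwa [ofReal_one, one_mul] at this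
    have h2 := h1.clog_real h
    rwa [neg_div_neg_eq, div_eq_mul_inv] at h2
  have hre (x y : ℝ) : (x + y * I - p : ℂ).re = x - p.re := by simp
  have him (x y : ℝ) : (x + y * I - p : ℂ).im = y - p.im := by simp
  have hne {x y : ℝ} (h : x ≠ p.re ∨ y ≠ p.im) : (x + y * I - p : ℂ) ≠ 0 := fun h0 => by
    have h1 := hre x y
    have h2 := him x y
    rw [h0] at h1 h2
    simp only [zero_re, zero_im] at h1 h2
    rcases h with h | h
    · exact h (by linarith)
    · exact h (by linarith)
  have i1 : ∫ x : ℝ in a..b, (x + c * I - p : ℂ)⁻¹ = log (b + c * I - p) - log (a + c * I - p) := by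
    refine intervalIntegral.integral_eq_sub_of_hasDerivAt (f := fun x : ℝ => log (x + c * I - p))
      (fun x _ => hhor c x (Or.inr (by rw [him]; linarith))) ?_
    exact (Continuous.inv₀ (by fun_prop) fun x => hne (Or.inr hc.ne)).intervalIntegrable _ _
  have i2 : ∫ x : ℝ in a..b, (x + d * I - p : ℂ)⁻¹ = log (b + d * I - p) - log (a + d * I - p) := by
    refine intervalIntegral.integral_eq_sub_of_hasDerivAt (f := fun x : ℝ => log (x + d * I - p))
      (fun x _ => hhor d x (Or.inr (by rw [him]; linarith))) ?_
    exact (Continuous.inv₀ (by fun_prop) fun x => hne (Or.inr hd.ne')).intervalIntegrable _ _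
  have i3 : I * ∫ y : ℝ in c..d, (b + y * I - p : ℂ)⁻¹
      = log (b + d * I - p) - log (b + c * I - p) := by
    rw [← intervalIntegral.integral_const_mul]
    refine intervalIntegral.integral_eq_sub_of_hasDerivAt (f := fun y : ℝ => log (b + y * I - p))
      (fun y _ => hver b y (Or.inl (by rw [hre]; linarith))) ?_
    exact (continuous_const.mul (Continuous.inv₀ (by fun_prop)
      fun y => hne (Or.inl hb.ne'))).intervalIntegrable _ _
  have i4 : I * ∫ y : ℝ in c..d, (a + y * I - p : ℂ)⁻¹
      = log (-(a + d * I - p)) - log (-(a + c * I - p)) := by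
    rw [← intervalIntegral.integral_const_mul]
    refine intervalIntegral.integral_eq_sub_of_hasDerivAt
      (f := fun y : ℝ => log (-(a + y * I - p)))
      (fun y _ => hver' a y (Or.inl (by rw [neg_re, hre]; linarith))) ?_
    exact (continuous_const.mul (Continuous.inv₀ (by fun_prop)
      fun y => hne (Or.inl ha.ne))).intervalIntegrable _ _
  have l1 : log (-(a + d * I - p)) = log (a + d * I - p) - Real.pi * I := by
    rw [log, log, norm_neg, arg_neg_eq_arg_sub_pi_of_im_pos (by rw [him]; linarith)]
    push_cast
    ring
  have l2 : log (-(a + c * I - p)) = log (a + c * I - p) + Real.pi * I := by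
    rw [log, log, norm_neg, arg_neg_eq_arg_add_pi_of_im_neg (by rw [him]; linarith)]
    push_cast
    ring
  rw [rectIntegral, i1, i2, smul_eq_mul, smul_eq_mul, i3, i4, l1, l2]
  ring

/-- The residue theorem on a rectangle, for finitely many simple poles: after subtraction of the
principal parts the integrand extends holomorphically. -/
lemma rectIntegral_eq_sum {f : ℂ → ℂ} {a b c d : ℝ} (hab : a ≤ b) (hcd : c ≤ d) (P : Finset ℂ)
    (res : ℂ → ℂ) (hP : ∀ p ∈ P, p ∈ Ioo a b ×ℂ Ioo c d)
    (hf : ∀ s ∈ Icc a b ×ℂ Icc c d, s ∉ P → DifferentiableAt ℂ f s)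
    (hres : ∀ p ∈ P, Tendsto (fun s => (s - p) * f s) (𝓝[≠] p) (𝓝 (res p))) :
    rectIntegral f a b c d = 2 * Real.pi * I * ∑ p ∈ P, res p := by
  classical
  set D : ℂ → ℂ := fun s => f s - ∑ p ∈ P, res p * (s - p)⁻¹ with hD
  set E : ℂ → ℂ := fun s => if s ∈ P then limUnder (𝓝[≠] s) D else D s with hE
  have hDd : ∀ s ∈ Icc a b ×ℂ Icc c d, s ∉ P → DifferentiableAt ℂ D s := fun s hs hsP => by
    refine (hf s hs hsP).sub (DifferentiableAt.fun_sum fun p hp => ?_)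
    have : s - p ≠ 0 := sub_ne_zero.2 fun h => hsP (h ▸ hp)
    exact ((differentiableAt_id.sub_const p).inv this).const_mul _
  have hopen : IsOpen (Ioo a b ×ℂ Ioo c d) := isOpen_Ioo.reProdIm isOpen_Ioo
  have hsub : Ioo a b ×ℂ Ioo c d ⊆ Icc a b ×ℂ Icc c d := fun s hs =>
    ⟨Ioo_subset_Icc_self hs.1, Ioo_subset_Icc_self hs.2⟩
  have hEd : ∀ s ∈ Icc a b ×ℂ Icc c d, DifferentiableAt ℂ E s := fun s hs => by
    by_cases hsP : s ∈ P
    · have hother : ∀ᶠ w in 𝓝 s, w ∉ P.erase s :=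
        (P.erase s).finite_toSet.isClosed.isOpen_compl.mem_nhds (by simp)
      have hev : ∀ᶠ w in 𝓝[≠] s, DifferentiableAt ℂ D w := by
        filter_upwards [mem_nhdsWithin_of_mem_nhds (hopen.mem_nhds (hP s hsP)),
          mem_nhdsWithin_of_mem_nhds hother, self_mem_nhdsWithin] with w h1 h2 h3
        exact hDd w (hsub h1) fun h => h2 (Finset.mem_erase.2 ⟨h3, h⟩)
      have h0 : Tendsto (fun w => (w - s) * D w) (𝓝[≠] s) (𝓝 0) := by
        have hrest : Tendsto (fun w => (w - s) * ∑ p ∈ P.erase s, res p * (w - p)⁻¹)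
            (𝓝[≠] s) (𝓝 0) := by
          have hcont : ContinuousAt (fun w => (w - s) * ∑ p ∈ P.erase s, res p * (w - p)⁻¹) s := by
            refine (continuousAt_id.sub continuousAt_const).mul
              (tendsto_finsetSum _ fun p hp => ?_)
            have : s - p ≠ 0 := sub_ne_zero.2 (Finset.ne_of_mem_erase hp).symm
            exact ((continuousAt_id.sub continuousAt_const).inv₀ this).const_mul _
          have := hcont.tendsto
          simp only [sub_self, zero_mul] at this
          exact this.mono_left nhdsWithin_le_nhds
        have h1 := ((hres s hsP).sub_const (res s)).sub hrest
        rw [sub_self, sub_zero] at h1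
        refine h1.congr' ?_
        filter_upwards [self_mem_nhdsWithin] with w hw
        have hws := sub_ne_zero.2 hw
        rw [hD]
        simp only
        rw [← Finset.add_sum_erase _ _ hsP, mul_sub, mul_add]
        field_simp
        ring
      refine (differentiableAt_update_limUnder hev h0).congr_of_eventuallyEq ?_
      filter_upwards [hother] with w hw
      rcases eq_or_ne w s with rfl | hne
      · simp [hE, hsP]
      · rw [Function.update_of_ne hne, hE]
        exact if_neg fun h => hw (Finset.mem_erase.2 ⟨hne, h⟩)
    · refine (hDd s hs hsP).congr_of_eventuallyEq ?_
      filter_upwards [P.finite_toSet.isClosed.isOpen_compl.mem_nhds hsP] with w hw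
      exact if_neg hw
  have hzero : rectIntegral E a b c d = 0 :=
    rectIntegral_eq_zero fun s hs => by
      rw [uIcc_of_le hab, uIcc_of_le hcd] at hs
      exact (hEd s hs).differentiableWithinAt
  -- on a side `γ` of the rectangle `f` is the sum of `E` and the principal parts
  have side (γ : ℝ → ℂ) (hγ : Continuous γ) (u v : ℝ) (huv : u ≤ v)
      (hmem : ∀ t ∈ Icc u v, γ t ∈ Icc a b ×ℂ Icc c d)
      (hbd : ∀ t ∈ Icc u v, γ t ∉ Ioo a b ×ℂ Ioo c d) :
      ∫ t in u..v, f (γ t)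
        = (∫ t in u..v, E (γ t)) + ∑ p ∈ P, res p * ∫ t in u..v, (γ t - p)⁻¹ := by
    have hne : ∀ t ∈ Icc u v, ∀ p ∈ P, γ t - p ≠ 0 := fun t ht p hp h =>
      hbd t ht (sub_eq_zero.1 h ▸ hP p hp)
    have hEi : IntervalIntegrable (fun t => E (γ t)) volume u v := by
      refine ContinuousOn.intervalIntegrable fun t ht => ?_
      rw [uIcc_of_le huv] at ht
      exact ((hEd _ (hmem t ht)).continuousAt.comp hγ.continuousAt).continuousWithinAt
    have hpi : ∀ p ∈ P, IntervalIntegrable (fun t => res p * (γ t - p)⁻¹) volume u v := by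
      refine fun p hp => ContinuousOn.intervalIntegrable fun t ht => ?_
      rw [uIcc_of_le huv] at ht
      exact (((hγ.continuousAt.sub continuousAt_const).inv₀ (hne t ht p hp)).const_mul
        _).continuousWithinAt
    simp_rw [← intervalIntegral.integral_const_mul]
    rw [← intervalIntegral.integral_finsetSum hpi, ← intervalIntegral.integral_add hEi
      (by simpa only [Finset.sum_fn] using IntervalIntegrable.sum P hpi)]
    refine intervalIntegral.integral_congr fun t ht => ?_
    rw [uIcc_of_le huv] at ht
    have hnot : γ t ∉ P := fun h => hbd t ht (hP _ h)
    simp [hE, hD, hnot]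
  have hinv : ∀ p ∈ P, rectIntegral (fun s => (s - p)⁻¹) a b c d = 2 * Real.pi * I :=
    fun p hp => rectIntegral_inv_sub (hP p hp).1.1 (hP p hp).1.2 (hP p hp).2.1 (hP p hp).2.2
  have hsplit : rectIntegral f a b c d
      = rectIntegral E a b c d + ∑ p ∈ P, res p * rectIntegral (fun s => (s - p)⁻¹) a b c d := by
    unfold rectIntegral
    rw [side (fun x => x + c * I) (by fun_prop) a b hab
        (fun t ht => ⟨by simpa using ht, by simpa using hcd⟩) (fun t ht h => by simpa using h.2.1),
      side (fun x => x + d * I) (by fun_prop) a b hab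
        (fun t ht => ⟨by simpa using ht, by simpa using hcd⟩) (fun t ht h => by simpa using h.2.2),
      side (fun y => b + y * I) (by fun_prop) c d hcd
        (fun t ht => ⟨by simpa using hab, by simpa using ht⟩) (fun t ht h => by simpa using h.1.2),
      side (fun y => a + y * I) (by fun_prop) c d hcd
        (fun t ht => ⟨by simpa using hab, by simpa using ht⟩) (fun t ht h => by simpa using h.1.1)]
    simp only [mul_add, mul_sub, Finset.sum_add_distrib, Finset.sum_sub_distrib, smul_eq_mul,
      mul_left_comm _ I, ← Finset.mul_sum]
    ring
  rw [hsplit, hzero, zero_add, Finset.sum_congr rfl fun p hp => by rw [hinv p hp],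
    ← Finset.sum_mul, mul_comm]

/-! ### `H` with its removable singularity at `1` filled in -/

/-- `H` with `1 / ζ(s)` written as `(s - 1) / ((s - 1) ζ(s))`, so that the value at `s = 1` is the
correct one, `0`; `H 1` itself is a junk value, since `riemannZeta 1` is. -/
noncomputable def Hext (s : ℂ) : ℂ :=
  eta s * (riemannZeta (2 * s) * ((s - 1) / riemannZeta₁ s)) * Gamma s

lemma Hext_eq_H {s : ℂ} (hs : s ≠ 1) : Hext s = H s := by
  have h1 := sub_ne_zero.2 hs
  rw [Hext, H, riemannZeta_eq_inv_sub_mul hs, div_eq_mul_inv (riemannZeta (2 * s)), mul_inv,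
    inv_inv, div_eq_mul_inv]

lemma riemannZeta₁_ne_zero_of_zeta {s : ℂ} (h : s ≠ 1 → riemannZeta s ≠ 0) :
    riemannZeta₁ s ≠ 0 := by
  rcases eq_or_ne s 1 with rfl | hs
  · simp
  · intro h0
    exact h hs (by rw [riemannZeta_eq_inv_sub_mul hs, h0, mul_zero])

lemma differentiableAt_eta {s : ℂ} (hs : 0 < s.re) : DifferentiableAt ℂ eta s := by
  have h1 : s + 1 ≠ 1 := fun h => by
    have := congrArg re h
    simp only [add_re, one_re] at this
    linarith
  have h2 : ((kappa / zetaTwo : ℝ) : ℂ) ≠ 0 := ofReal_ne_zero.2 kappa_div_zetaTwo_pos.ne'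
  have h3 : DifferentiableAt ℂ (fun s => riemannZeta (s + 1)) s :=
    (differentiableAt_riemannZeta h1).comp s (by fun_prop : DifferentiableAt ℂ (fun s => s + 1) s)
  have h4 : DifferentiableAt ℂ (fun s => ((kappa / zetaTwo : ℝ) : ℂ) ^ s) s :=
    differentiableAt_id.const_cpow (Or.inl h2)
  have h5 : DifferentiableAt ℂ (fun s => (2 : ℂ) ^ (-s - 1)) s :=
    DifferentiableAt.const_cpow (by fun_prop) (Or.inl two_ne_zero)
  exact (h4.mul (h5.const_sub 1)).mul h3

lemma differentiableAt_Gamma_of_re_pos {s : ℂ} (hs : 0 < s.re) : DifferentiableAt ℂ Gamma s :=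
  differentiableAt_Gamma s fun m h => by
    rw [h] at hs
    simp at hs
    linarith [(m.cast_nonneg : (0 : ℝ) ≤ m)]

lemma differentiableAt_zeta_two_mul {s : ℂ} (hs : s ≠ 1 / 2) :
    DifferentiableAt ℂ (fun s => riemannZeta (2 * s)) s := by
  have h : 2 * s ≠ 1 := fun h => hs (by rw [← h]; ring)
  exact (differentiableAt_riemannZeta h).comp s
    (by fun_prop : DifferentiableAt ℂ (fun s => 2 * s) s)

lemma differentiableAt_Hext {s : ℂ} (h0 : 0 < s.re) (h2 : s ≠ 1 / 2)
    (hz : s ≠ 1 → riemannZeta s ≠ 0) : DifferentiableAt ℂ Hext s := by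
  have h4 : DifferentiableAt ℂ (fun s => (s - 1) / riemannZeta₁ s) s :=
    (by fun_prop : DifferentiableAt ℂ (fun s : ℂ => s - 1) s).div
      differentiable_riemannZeta₁.differentiableAt (riemannZeta₁_ne_zero_of_zeta hz)
  exact ((differentiableAt_eta h0).mul ((differentiableAt_zeta_two_mul h2).mul h4)).mul
    (differentiableAt_Gamma_of_re_pos h0)

lemma re_eq_one_half_of_zeta_eq_zero (hRH : RiemannHypothesis) {s : ℂ} (h0 : 0 < s.re)
    (hz : riemannZeta s = 0) : s.re = 1 / 2 := by
  refine hRH s hz ?_ fun h => riemannZeta_one_ne_zero (h ▸ hz)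
  rintro ⟨n, rfl⟩
  simp at h0
  linarith [(n.cast_nonneg : (0 : ℝ) ≤ n)]

lemma differentiableAt_Hext_of_re_ne (hRH : RiemannHypothesis) {s : ℂ} (h0 : 0 < s.re)
    (h2 : s.re ≠ 1 / 2) : DifferentiableAt ℂ Hext s :=
  differentiableAt_Hext h0 (fun h => h2 (by rw [h]; norm_num))
    fun _ hz => h2 (re_eq_one_half_of_zeta_eq_zero hRH h0 hz)

/-! ### The poles of `H` -/

lemma tendsto_sub_mul_Hext_one_half :
    Tendsto (fun s => (s - 1 / 2) * Hext s) (𝓝[≠] (1 / 2))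
      (𝓝 (1 / 2 * (eta (1 / 2) / riemannZeta (1 / 2)) * Gamma (1 / 2))) := by
  have hre : (0 : ℝ) < (1 / 2 : ℂ).re := by norm_num
  have hz1 : riemannZeta₁ (1 / 2) ≠ 0 :=
    riemannZeta₁_ne_zero_of_zeta fun _ => riemannZeta_one_half_ne_zero
  have hcont : ContinuousAt (fun s => eta s * (1 / 2 * riemannZeta₁ (2 * s) *
      ((s - 1) / riemannZeta₁ s)) * Gamma s) (1 / 2) := by
    have c1 := (differentiableAt_eta hre).continuousAt
    have c2 := (differentiableAt_Gamma_of_re_pos hre).continuousAt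
    have c3 : Continuous riemannZeta₁ := differentiable_riemannZeta₁.continuous
    have c4 : ContinuousAt (fun s : ℂ => (s - 1) / riemannZeta₁ s) (1 / 2) :=
      ContinuousAt.div (by fun_prop) c3.continuousAt hz1
    have c5 : ContinuousAt (fun s : ℂ => 1 / 2 * riemannZeta₁ (2 * s)) (1 / 2) := by fun_prop
    exact (c1.mul (c5.mul c4)).mul c2
  have h := hcont.tendsto.mono_left (nhdsWithin_le_nhds (s := {1 / 2}ᶜ))
  have hval : eta (1 / 2) * (1 / 2 * riemannZeta₁ (2 * (1 / 2)) *
      ((1 / 2 - 1) / riemannZeta₁ (1 / 2))) * Gamma (1 / 2)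
      = 1 / 2 * (eta (1 / 2) / riemannZeta (1 / 2)) * Gamma (1 / 2) := by
    rw [riemannZeta_eq_inv_sub_mul (by norm_num : (1 / 2 : ℂ) ≠ 1),
      show (2 * (1 / 2) : ℂ) = 1 by norm_num, riemannZeta₁_one]
    have : (1 / 2 - 1 : ℂ) ≠ 0 := by norm_num
    field_simp
  rw [hval] at h
  refine h.congr' ?_
  filter_upwards [self_mem_nhdsWithin] with s hs
  have h2 : 2 * s ≠ 1 := fun h => hs (by rw [mem_singleton_iff, ← h]; ring)
  have h3 : 2 * s - 1 ≠ 0 := sub_ne_zero.2 h2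
  rw [Hext, riemannZeta_eq_inv_sub_mul h2]
  field_simp

lemma deriv_riemannZeta_ne_zero (hSH : SimplicityHypothesis) {ρ : ℂ} (hz : riemannZeta ρ = 0)
    (hre : ρ.re = 1 / 2) : deriv riemannZeta ρ ≠ 0 := by
  have h1 : ρ ≠ 1 := fun h => by rw [h] at hre; norm_num at hre
  have han : AnalyticAt ℂ riemannZeta ρ :=
    differentiableOn_riemannZeta.analyticAt (isOpen_compl_singleton.mem_nhds h1)
  have hord := hSH ρ (by rw [hre]; norm_num) (by rw [hre]; norm_num) hz
  have h2 := han.analyticOrderAt_deriv_add_one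
  simp only [hz, sub_zero] at h2
  rw [hord] at h2
  refine (han.deriv.analyticOrderAt_eq_zero).1 ?_
  simpa using h2

lemma ne_one_half_of_zeta_eq_zero {ρ : ℂ} (hz : riemannZeta ρ = 0) : ρ ≠ 1 / 2 := fun h =>
  riemannZeta_one_half_ne_zero (h ▸ hz)

lemma tendsto_sub_mul_Hext_zero (hSH : SimplicityHypothesis) {ρ : ℂ} (hz : riemannZeta ρ = 0)
    (hre : ρ.re = 1 / 2) :
    Tendsto (fun s => (s - ρ) * Hext s) (𝓝[≠] ρ)
      (𝓝 (eta ρ * (riemannZeta (2 * ρ) / deriv riemannZeta ρ) * Gamma ρ)) := by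
  have h1 : ρ ≠ 1 := fun h => by rw [h] at hre; norm_num at hre
  have h0 : 0 < ρ.re := by rw [hre]; norm_num
  have hd := (differentiableAt_riemannZeta h1).hasDerivAt
  have hslope := (hasDerivAt_iff_tendsto_slope.1 hd).inv₀ (deriv_riemannZeta_ne_zero hSH hz hre)
  have c1 := (differentiableAt_eta h0).continuousAt.tendsto.mono_left
    (nhdsWithin_le_nhds (s := {ρ}ᶜ))
  have c2 := (differentiableAt_Gamma_of_re_pos h0).continuousAt.tendsto.mono_left
    (nhdsWithin_le_nhds (s := {ρ}ᶜ))
  have c3 := (differentiableAt_zeta_two_mul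
    (ne_one_half_of_zeta_eq_zero hz)).continuousAt.tendsto.mono_left
    (nhdsWithin_le_nhds (s := {ρ}ᶜ))
  have h := (c1.mul (c3.mul hslope)).mul c2
  rw [← div_eq_mul_inv] at h
  refine h.congr' ?_
  filter_upwards [mem_nhdsWithin_of_mem_nhds (isOpen_ne.mem_nhds h1)] with s hs
  rw [Hext_eq_H hs, H, slope_def_field, hz, sub_zero, inv_div]
  ring

lemma eventually_differentiableAt_Hext {p : ℂ} (hp : p.re = 1 / 2) :
    ∀ᶠ s in 𝓝[≠] p, DifferentiableAt ℂ Hext s := by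
  have hp1 : p ≠ 1 := fun h => by rw [h] at hp; norm_num at hp
  set S : Set ℂ := closedBall p 1 ∩ riemannZetaZeros ∪ {1 / 2}
  have hfin : S.Finite :=
    ((isCompact_closedBall p 1).inter_riemannZetaZeros_finite).union (finite_singleton _)
  have hmem : ∀ᶠ s in 𝓝 p, s ∉ S \ {p} :=
    (hfin.subset sdiff_subset).isClosed.isOpen_compl.mem_nhds (by simp)
  have hpos : ∀ᶠ s in 𝓝 p, 0 < s.re :=
    (isOpen_lt continuous_const continuous_re).mem_nhds (by simp [hp])
  filter_upwards [mem_nhdsWithin_of_mem_nhds hmem, mem_nhdsWithin_of_mem_nhds hpos,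
    mem_nhdsWithin_of_mem_nhds (closedBall_mem_nhds p one_pos), self_mem_nhdsWithin]
    with s h1 h2 h3 h4
  refine differentiableAt_Hext h2 (fun h => h1 ⟨Or.inr h, h4⟩) fun _ hz => h1 ⟨Or.inl ⟨h3, hz⟩, h4⟩

lemma residue_H_eq {p c : ℂ} (hp : p.re = 1 / 2)
    (h : Tendsto (fun s => (s - p) * Hext s) (𝓝[≠] p) (𝓝 c)) : residue H p = c := by
  have hp1 : p ≠ 1 := fun h => by rw [h] at hp; norm_num at hp
  have hopen := (isOpen_ne (x := (1 : ℂ)))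
  refine residue_eq_of_tendsto ?_ (h.congr' ?_)
  · filter_upwards [eventually_differentiableAt_Hext hp,
      mem_nhdsWithin_of_mem_nhds (hopen.mem_nhds hp1)] with s hs hs1
    refine hs.congr_of_eventuallyEq ?_
    filter_upwards [hopen.mem_nhds hs1] with w hw
    exact (Hext_eq_H hw).symm
  · filter_upwards [mem_nhdsWithin_of_mem_nhds (hopen.mem_nhds hp1)] with s hs
    rw [Hext_eq_H hs]

lemma residue_H_one_half :
    residue H (1 / 2) = 1 / 2 * (eta (1 / 2) / riemannZeta (1 / 2)) * Gamma (1 / 2) :=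
  residue_H_eq (by norm_num) tendsto_sub_mul_Hext_one_half

lemma residue_H_zero (hSH : SimplicityHypothesis) {ρ : ℂ}
    (hz : riemannZeta ρ = 0) (hre : ρ.re = 1 / 2) :
    residue H ρ = eta ρ * (riemannZeta (2 * ρ) / deriv riemannZeta ρ) * Gamma ρ :=
  residue_H_eq hre (tendsto_sub_mul_Hext_zero hSH hz hre)

/-! ### The integral over a vertical line -/

/-- A continuous function bounded by `K e^{-|t|}` for `|t| ≥ T` is integrable, and its integral is
that over `[-T, T]` up to `2 K e^{-T}`. -/
lemma integrable_and_norm_integral_sub_le {g : ℝ → ℂ} (hg : Continuous g) {K T : ℝ} (hT : 0 ≤ T)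
    (hb : ∀ t, T ≤ |t| → ‖g t‖ ≤ K * Real.exp (-|t|)) :
    Integrable g ∧ ‖(∫ t, g t) - ∫ t in -T..T, g t‖ ≤ 2 * K * Real.exp (-T) := by
  have hbI : ∀ᵐ t ∂volume.restrict (Ioi T), ‖g t‖ ≤ K * Real.exp (-t) := by
    filter_upwards [ae_restrict_mem measurableSet_Ioi] with t ht
    have h0 : 0 < t := hT.trans_lt ht
    simpa [abs_of_pos h0] using hb t (by rw [abs_of_pos h0]; exact ht.le)
  have hbJ : ∀ᵐ t ∂volume.restrict (Iic (-T)), ‖g t‖ ≤ K * Real.exp t := by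
    filter_upwards [ae_restrict_mem measurableSet_Iic] with t ht
    have h0 : t ≤ 0 := le_trans ht (by linarith)
    have h1 : T ≤ -t := by linarith [mem_Iic.1 ht]
    simpa [abs_of_nonpos h0] using hb t (by rwa [abs_of_nonpos h0])
  have eI : IntegrableOn (fun t => K * Real.exp (-t)) (Ioi T) :=
    (integrableOn_exp_neg_Ioi T).const_mul K
  have eJ : IntegrableOn (fun t => K * Real.exp t) (Iic (-T)) :=
    (integrableOn_exp_Iic (-T)).const_mul K
  have iI : IntegrableOn g (Ioi T) := eI.mono' hg.aestronglyMeasurable hbI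
  have iJ : IntegrableOn g (Iic (-T)) := eJ.mono' hg.aestronglyMeasurable hbJ
  have iM : IntegrableOn g (Ioc (-T) T) := hg.integrableOn_Ioc
  have hTT : -T ≤ T := by linarith
  have hint : Integrable g := by
    rw [← integrableOn_univ, ← Iic_union_Ioi (a := T), ← Iic_union_Ioc_eq_Iic hTT]
    exact (iJ.union iM).union iI
  refine ⟨hint, ?_⟩
  have hsplit : (∫ t, g t) - ∫ t in -T..T, g t = (∫ t in Iic (-T), g t) + ∫ t in Ioi T, g t := by
    rw [← intervalIntegral.integral_Iic_sub_Iic hint.integrableOn hint.integrableOn,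
      ← intervalIntegral.integral_Iic_add_Ioi (b := T) hint.integrableOn hint.integrableOn]
    ring
  rw [hsplit]
  have n1 : ‖∫ t in Iic (-T), g t‖ ≤ K * Real.exp (-T) :=
    (norm_integral_le_of_norm_le eJ hbJ).trans
      (by rw [integral_const_mul, integral_exp_Iic])
  have n2 : ‖∫ t in Ioi T, g t‖ ≤ K * Real.exp (-T) :=
    (norm_integral_le_of_norm_le eI hbI).trans
      (by rw [integral_const_mul, integral_exp_neg_Ioi])
  linarith [norm_add_le (∫ t in Iic (-T), g t) (∫ t in Ioi T, g t)]

/-- The integrand `H(s) x^(s/2)` of `φ₀(x)`, regular at `s = 1`. -/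
noncomputable def phi0Fun (x : ℝ) (s : ℂ) : ℂ := Hext s * (x : ℂ) ^ (s / 2)

lemma differentiable_cpow_half {x : ℝ} (hx : 0 < x) :
    Differentiable ℂ fun s : ℂ => (x : ℂ) ^ (s / 2) := fun s =>
  DifferentiableAt.const_cpow (by fun_prop) (Or.inl (ofReal_ne_zero.2 hx.ne'))

lemma differentiableAt_phi0Fun_of_re_ne (hRH : RiemannHypothesis) {x : ℝ} (hx : 0 < x) {s : ℂ}
    (h0 : 0 < s.re) (h2 : s.re ≠ 1 / 2) : DifferentiableAt ℂ (phi0Fun x) s :=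
  (differentiableAt_Hext_of_re_ne hRH h0 h2).mul (differentiable_cpow_half hx s)

lemma norm_phi0Fun {x : ℝ} (hx : 0 < x) (s : ℂ) :
    ‖phi0Fun x s‖ = ‖Hext s‖ * x ^ (s.re / 2) := by
  rw [phi0Fun, norm_mul, norm_cpow_eq_rpow_re_of_pos hx]
  congr 2
  rw [show s / 2 = s / ((2 : ℝ) : ℂ) by simp, div_ofReal_re]

lemma continuous_phi0Fun_line (hRH : RiemannHypothesis) {x σ : ℝ} (hx : 0 < x) (h0 : 0 < σ)
    (h2 : σ ≠ 1 / 2) : Continuous fun t : ℝ => phi0Fun x (σ + t * I) :=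
  continuous_iff_continuousAt.2 fun t =>
    (differentiableAt_phi0Fun_of_re_ne hRH hx (s := σ + t * I) (by simpa using h0)
      (by simpa using h2)).continuousAt.comp (f := fun t : ℝ => (σ + t * I : ℂ)) (by fun_prop)

lemma phi0Integrand_ae_eq (σ x : ℝ) :
    phi0Integrand σ x =ᵐ[volume] fun t : ℝ => phi0Fun x (σ + t * I) := by
  filter_upwards [(countable_singleton (0 : ℝ)).ae_notMem volume] with t ht
  rw [phi0Integrand, phi0Fun, Hext_eq_H]
  intro h
  have := congrArg im h
  simp at this
  exact ht this

lemma phi0_eq (σ x : ℝ) :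
    phi0 σ x = (2 * (Real.pi : ℂ))⁻¹ * ∫ t : ℝ, phi0Fun x (σ + t * I) := by
  rw [phi0, integral_congr_ae (phi0Integrand_ae_eq σ x)]

/-- Away from the critical line, RH alone keeps `H` small at large heights. -/
lemma exists_norm_Hext_le (hRH : RiemannHypothesis) {δ : ℝ} (hδ : 0 < δ) (σ : ℝ) :
    ∃ t₀ : ℝ, 2 ≤ t₀ ∧ ∀ s : ℂ, 1 / 3 ≤ s.re → s.re ≤ σ → δ ≤ |s.re - 1 / 2| → t₀ ≤ |s.im| →
      ‖Hext s‖ ≤ Real.exp (-|s.im|) := by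
  obtain ⟨t₀, h2, hH⟩ := exists_norm_H_le hRH one_pos σ
  obtain ⟨t₁, h1⟩ :=
    (Real.tendsto_log_atTop.eventually_ge_atTop (1 / δ)).exists_forall_of_atTop
  refine ⟨max t₀ t₁, h2.trans (le_max_left _ _), fun s hs hσ hd ht => ?_⟩
  have ht0 := (le_max_left _ _).trans ht
  have hne : s ≠ 1 := fun h => by
    rw [h, one_im, abs_zero] at ht0
    linarith
  rw [Hext_eq_H hne]
  refine hH s hs hσ ht0 fun ρ hz hre => ?_
  have hl := h1 _ ((le_max_right _ _).trans ht)
  have h3 := abs_re_le_norm (s - ρ)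
  rw [sub_re, hre] at h3
  rw [one_mul]
  refine le_trans ?_ (hd.trans h3)
  rw [div_le_iff₀ (lt_of_lt_of_le (by positivity) hl)]
  rwa [div_le_iff₀' hδ] at hl

lemma exists_line_bound (hRH : RiemannHypothesis) {σ : ℝ} (h3 : 1 / 3 ≤ σ) (h2 : σ ≠ 1 / 2) :
    ∃ t₀ : ℝ, 2 ≤ t₀ ∧ ∀ x : ℝ, 0 < x → ∀ t : ℝ, t₀ ≤ |t| →
      ‖phi0Fun x (σ + t * I)‖ ≤ x ^ (σ / 2) * Real.exp (-|t|) := by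
  obtain ⟨t₀, ht₀, h⟩ := exists_norm_Hext_le hRH (abs_pos.2 (sub_ne_zero.2 h2)) σ
  refine ⟨t₀, ht₀, fun x hx t ht => ?_⟩
  have := h (σ + t * I) (by simpa using h3) (by simp) (by simp) (by simpa using ht)
  rw [norm_phi0Fun hx, mul_comm]
  simp only [add_re, ofReal_re, mul_re, I_re, mul_zero, ofReal_im, I_im, mul_one, sub_self,
    add_zero, add_im, mul_im, zero_add] at this ⊢
  gcongr

lemma integrable_phi0Fun_line (hRH : RiemannHypothesis) {σ x : ℝ} (hx : 0 < x) (h3 : 1 / 3 ≤ σ)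
    (h2 : σ ≠ 1 / 2) : Integrable fun t : ℝ => phi0Fun x (σ + t * I) := by
  obtain ⟨t₀, ht₀, h⟩ := exists_line_bound hRH h3 h2
  exact (integrable_and_norm_integral_sub_le
    (continuous_phi0Fun_line hRH hx (by linarith) h2) (by linarith) (h x hx)).1

lemma tendsto_rectIntegral_horizontal (hRH : RiemannHypothesis) {σ₁ σ₂ x : ℝ} (hx : 0 < x)
    (h1 : 1 / 2 < σ₁) (h12 : σ₁ ≤ σ₂) {ε : ℝ} (hε : |ε| = 1) :
    Tendsto (fun T : ℝ => ∫ u in σ₁..σ₂, phi0Fun x (u + (ε * T : ℝ) * I)) atTop (𝓝 0) := by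
  obtain ⟨t₀, ht₀, h⟩ := exists_norm_Hext_le hRH (sub_pos.2 h1) σ₂
  have hlim : Tendsto (fun T : ℝ => Real.exp (-T) * (1 + x) ^ (σ₂ / 2) * |σ₂ - σ₁|) atTop
      (𝓝 0) := by
    have := (Real.tendsto_exp_neg_atTop_nhds_zero.mul_const ((1 + x) ^ (σ₂ / 2))).mul_const
      |σ₂ - σ₁|
    simpa using this
  refine squeeze_zero_norm' ?_ hlim
  filter_upwards [eventually_ge_atTop t₀] with T hT
  refine intervalIntegral.norm_integral_le_of_norm_le_const fun u hu => ?_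
  rw [uIoc_of_le h12] at hu
  have hre : ((u : ℂ) + (ε * T : ℝ) * I).re = u := by simp
  have him : |((u : ℂ) + (ε * T : ℝ) * I).im| = T := by
    have : ((u : ℂ) + (ε * T : ℝ) * I).im = ε * T := by simp
    rw [this, abs_mul, hε, one_mul, abs_of_nonneg (by linarith)]
  have hb := h (u + (ε * T : ℝ) * I) (by rw [hre]; linarith [hu.1]) (by rw [hre]; exact hu.2)
    (by rw [hre]; exact le_trans (by linarith [hu.1]) (le_abs_self _)) (by rwa [him])
  rw [him] at hb
  rw [norm_phi0Fun hx, hre]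
  gcongr
  calc x ^ (u / 2) ≤ (1 + x) ^ (u / 2) :=
        Real.rpow_le_rpow hx.le (by linarith) (by linarith [hu.1])
    _ ≤ (1 + x) ^ (σ₂ / 2) :=
        Real.rpow_le_rpow_of_exponent_le (by linarith) (by linarith [hu.2])

/-- Shifting the line of integration within `Re s > 1/2` meets no pole. -/
lemma integral_line_eq_of_le (hRH : RiemannHypothesis) {σ₁ σ₂ x : ℝ} (hx : 0 < x)
    (h1 : 1 / 2 < σ₁) (h12 : σ₁ ≤ σ₂) :
    ∫ t : ℝ, phi0Fun x (σ₁ + t * I) = ∫ t : ℝ, phi0Fun x (σ₂ + t * I) := by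
  have hside (σ : ℝ) (hσ : 1 / 2 < σ) :
      Tendsto (fun T : ℝ => ∫ t in -T..T, phi0Fun x (σ + t * I)) atTop
        (𝓝 (∫ t : ℝ, phi0Fun x (σ + t * I))) :=
    intervalIntegral_tendsto_integral (integrable_phi0Fun_line hRH hx (by linarith) hσ.ne')
      tendsto_neg_atTop_atBot tendsto_id
  have hbot := tendsto_rectIntegral_horizontal hRH hx h1 h12 (ε := -1) (by simp)
  have htop := tendsto_rectIntegral_horizontal hRH hx h1 h12 (ε := 1) (by simp)
  have hlim := ((hbot.sub htop).add ((hside σ₂ (by linarith)).const_smul I)).sub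
    ((hside σ₁ h1).const_smul I)
  have hzero : ∀ T : ℝ, rectIntegral (phi0Fun x) σ₁ σ₂ (-T) T = 0 := fun T =>
    rectIntegral_eq_zero fun s hs => by
      have : σ₁ ≤ s.re := by
        have := hs.1
        rw [mem_preimage, uIcc_of_le h12] at this
        exact this.1
      exact (differentiableAt_phi0Fun_of_re_ne hRH hx (by linarith)
        (by linarith)).differentiableWithinAt
  have h0 := tendsto_nhds_unique (tendsto_const_nhds (x := (0 : ℂ)) (f := (atTop : Filter ℝ)))
    (hlim.congr fun T => by simpa [rectIntegral] using hzero T)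
  have h3 : I • ((∫ t : ℝ, phi0Fun x (σ₂ + t * I)) - ∫ t : ℝ, phi0Fun x (σ₁ + t * I)) = 0 := by
    rw [smul_sub, h0]
    ring
  rw [smul_eq_mul] at h3
  exact (sub_eq_zero.1 ((mul_eq_zero.1 h3).resolve_left I_ne_zero)).symm

lemma phi0_eq_phi0_two (hRH : RiemannHypothesis) {σ x : ℝ} (hx : 0 < x) (h : 1 / 2 < σ) :
    phi0 σ x = (2 * (Real.pi : ℂ))⁻¹ * ∫ t : ℝ, phi0Fun x ((2 : ℝ) + t * I) := by
  rw [phi0_eq]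
  rcases le_total σ 2 with h2 | h2
  · rw [integral_line_eq_of_le hRH hx h h2]
  · rw [integral_line_eq_of_le hRH hx (by norm_num) h2]

/-! ### Heights far from the zeros -/

/-- Finitely many points cannot come close to every point of a unit interval. -/
lemma exists_mem_Icc_forall_le_abs_sub (S : Finset ℝ) (a : ℝ) :
    ∃ T ∈ Icc a (a + 1), ∀ γ ∈ S, 1 / (4 * (S.card + 1 : ℝ)) ≤ |T - γ| := by
  set d : ℝ := 1 / (4 * (S.card + 1 : ℝ)) with hd
  have hd0 : 0 < d := by positivity
  by_contra! h
  have hsub : Icc a (a + 1) ⊆ ⋃ γ ∈ S, ball γ d := fun T hT => by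
    obtain ⟨γ, hγ, hlt⟩ := h T hT
    exact mem_biUnion hγ (by rwa [mem_ball, Real.dist_eq])
  have h1 := (measure_mono hsub).trans (measure_biUnion_finset_le S (μ := volume) _)
  simp only [Real.volume_ball, Real.volume_Icc, Finset.sum_const, nsmul_eq_mul] at h1
  rw [← ENNReal.ofReal_natCast, ← ENNReal.ofReal_mul (by positivity),
    ENNReal.ofReal_le_ofReal_iff (by positivity)] at h1
  have h2 : (S.card : ℝ) * (2 * d) < 1 := by
    rw [hd]
    have : (0 : ℝ) ≤ S.card := by positivity
    rw [mul_one_div, mul_div_assoc', div_lt_one (by positivity)]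
    linarith
  linarith

/-- Every unit interval far enough out contains a height `T` at distance `1 / (56 log T)` from the
absolute values of all ordinates of zeros on the critical line. -/
lemma exists_height :
    ∃ a₀ : ℝ, ∀ a : ℝ, a₀ ≤ a → ∃ T ∈ Icc a (a + 1), ∀ ρ : ℂ, riemannZeta ρ = 0 → ρ.re = 1 / 2 →
      1 / (56 * Real.log T) ≤ |T - (|ρ.im|)| := by
  obtain ⟨t₀, ht₀, hZ⟩ := exists_zeta_zeros_and_lower_bound
  refine ⟨t₀, fun a ha => ?_⟩
  have ha10 : 10 ≤ a := ht₀.trans ha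
  have haa : |a| = a := abs_of_pos (by linarith)
  obtain ⟨Z, hcard, -, hmem, -⟩ := hZ a (by rwa [haa])
  rw [haa] at hcard
  obtain ⟨T, hT, hdist⟩ := exists_mem_Icc_forall_le_abs_sub (Z.image im) a
  refine ⟨T, hT, fun ρ hz hre => ?_⟩
  have hlog1 : 1 ≤ Real.log a := by
    rw [Real.le_log_iff_exp_le (by linarith)]
    linarith [Real.exp_one_lt_d9]
  have hlogT : Real.log a ≤ Real.log T := Real.log_le_log (by linarith) hT.1
  have hcount : ((Z.image im).card : ℝ) + 1 ≤ 14 * Real.log a := by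
    have h1 : ((Z.image im).card : ℝ) ≤ Z.card := by exact_mod_cast Finset.card_image_le
    have h2 : 9 * Real.log a / Real.log 2 ≤ 13 * Real.log a := by
      rw [div_le_iff₀ (Real.log_pos one_lt_two)]
      nlinarith [Real.log_two_gt_d9]
    linarith
  have hd : 1 / (56 * Real.log T) ≤ 1 / (4 * ((Z.image im).card + 1 : ℝ)) := by
    apply one_div_le_one_div_of_le (by positivity)
    linarith
  -- by conjugation symmetry only zeros in the upper half plane matter
  obtain ⟨w, hwz, hwre, hwim⟩ : ∃ w : ℂ, riemannZeta w = 0 ∧ w.re = 1 / 2 ∧ w.im = |ρ.im| := by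
    rcases le_total 0 ρ.im with h | h
    · exact ⟨ρ, hz, hre, (abs_of_nonneg h).symm⟩
    · exact ⟨(starRingEnd ℂ) ρ, by rw [riemannZeta_conj, hz, map_zero], by simpa using hre,
        by rw [conj_im, abs_of_nonpos h]⟩
  rw [← hwim]
  by_cases hclose : |w.im - a| ≤ 2
  · refine hd.trans (hdist _ (Finset.mem_image_of_mem _ (hmem w ?_ hwz)))
    rw [mem_closedBall, dist_eq_norm, norm_def, Real.sqrt_le_left (by norm_num), normSq_apply]
    have h1 : (w - (2 + a * I)).re = -(3 / 2) := by
      simp [hwre]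
      norm_num
    have h2 : (w - (2 + a * I)).im = w.im - a := by simp
    rw [h1, h2]
    have := abs_le.1 hclose
    nlinarith
  · have h1 : 1 / (56 * Real.log T) ≤ 1 := by
      rw [div_le_one (by linarith)]
      linarith
    refine h1.trans ?_
    by_contra! hlt
    refine hclose (abs_le.2 ?_)
    have := abs_lt.1 hlt
    constructor <;> linarith [hT.1, hT.2]

/-! ### The contour shift -/

lemma mem_criticalZeros {T : ℝ} {ρ : ℂ} :
    ρ ∈ criticalZeros T ↔ riemannZeta ρ = 0 ∧ ρ.re = 1 / 2 ∧ |ρ.im| < T := by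
  simp [criticalZeros, criticalZeroSet]

/-- The residue theorem for `H(s) x^(s/2)` on `[1/3, 2] × [-T, T]`. -/
lemma rectIntegral_phi0Fun (hRH : RiemannHypothesis) (hSH : SimplicityHypothesis) {x T : ℝ}
    (hx : 0 < x) (hT : 0 < T) (hgap : ∀ ρ : ℂ, riemannZeta ρ = 0 → ρ.re = 1 / 2 → |ρ.im| ≠ T) :
    rectIntegral (phi0Fun x) (1 / 3) 2 (-T) T = 2 * Real.pi * I *
      (-cZero * (x : ℂ) ^ (1 / 4 : ℂ) + ∑ ρ ∈ criticalZeros T, cRes ρ * (x : ℂ) ^ (ρ / 2)) := by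
  classical
  have hnot : (1 / 2 : ℂ) ∉ criticalZeros T := fun h =>
    riemannZeta_one_half_ne_zero (mem_criticalZeros.1 h).1
  have hres (p : ℂ) (h : Tendsto (fun s => (s - p) * Hext s) (𝓝[≠] p) (𝓝 (residue H p))) :
      Tendsto (fun s => (s - p) * phi0Fun x s) (𝓝[≠] p)
        (𝓝 (residue H p * (x : ℂ) ^ (p / 2))) := by
    have h1 := (differentiable_cpow_half hx).continuous.continuousAt (x := p) |>.tendsto.mono_left
      (nhdsWithin_le_nhds (s := {p}ᶜ))
    refine (h.mul h1).congr fun s => ?_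
    rw [phi0Fun]
    ring
  rw [rectIntegral_eq_sum (by norm_num) (by linarith) (insert (1 / 2) (criticalZeros T))
    (fun p => residue H p * (x : ℂ) ^ (p / 2)) ?_ ?_ ?_]
  · rw [Finset.sum_insert hnot, cZero, neg_neg]
    norm_num [cRes]
  · intro p hp
    rcases Finset.mem_insert.1 hp with rfl | hp
    · constructor <;> constructor <;> norm_num <;> linarith
    · obtain ⟨-, hre, him⟩ := mem_criticalZeros.1 hp
      have := abs_lt.1 him
      refine ⟨?_, this⟩
      rw [mem_preimage, hre]
      norm_num
  · intro s hs hsP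
    rw [Finset.mem_insert, not_or] at hsP
    have hs0 : 0 < s.re := lt_of_lt_of_le (by norm_num) hs.1.1
    refine (differentiableAt_Hext hs0 hsP.1 fun _ hz => hsP.2 ?_).mul
      (differentiable_cpow_half hx s)
    have hre := re_eq_one_half_of_zeta_eq_zero hRH hs0 hz
    exact mem_criticalZeros.2 ⟨hz, hre, lt_of_le_of_ne (abs_le.2 hs.2) (hgap s hz hre)⟩
  · intro p hp
    rcases Finset.mem_insert.1 hp with rfl | hp
    · refine hres _ ?_
      rw [residue_H_one_half]
      exact tendsto_sub_mul_Hext_one_half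
    · obtain ⟨hz, hre, -⟩ := mem_criticalZeros.1 hp
      refine hres _ ?_
      rw [residue_H_zero hSH hz hre]
      exact tendsto_sub_mul_Hext_zero hSH hz hre

/-- On the segments `Im s = ±T` with `T` far from the zeros, `H` is at most `e^{-T} ≤ 1 / x`. -/
lemma norm_horizontal_le {x T t₀ : ℝ} (hx : 1 ≤ x) (hT : Real.log x ≤ T) (h0 : 2 ≤ t₀)
    (ht₀ : t₀ ≤ T)
    (hH : ∀ s : ℂ, 1 / 3 ≤ s.re → s.re ≤ 2 → t₀ ≤ |s.im| →
      (∀ ρ : ℂ, riemannZeta ρ = 0 → ρ.re = 1 / 2 → 1 / (56 * Real.log |s.im|) ≤ ‖s - ρ‖) →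
      ‖H s‖ ≤ Real.exp (-|s.im|))
    (hgap : ∀ ρ : ℂ, riemannZeta ρ = 0 → ρ.re = 1 / 2 → 1 / (56 * Real.log T) ≤ |T - (|ρ.im|)|)
    {y : ℝ} (hy : |y| = T) : ‖∫ u in (1 / 3 : ℝ)..2, phi0Fun x (u + y * I)‖ ≤ 2 := by
  have hx0 : 0 < x := by linarith
  have hbound : ∀ u ∈ uIoc (1 / 3 : ℝ) 2, ‖phi0Fun x (u + y * I)‖ ≤ 1 := by
    intro u hu
    rw [uIoc_of_le (by norm_num)] at hu
    have hre : ((u : ℂ) + y * I).re = u := by simp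
    have him : ((u : ℂ) + y * I).im = y := by simp
    have hne : (u : ℂ) + y * I ≠ 1 := fun h => by
      rw [h, one_im] at him
      rw [← him, abs_zero] at hy
      linarith
    have hb := hH (u + y * I) (by rw [hre]; exact hu.1.le) (by rw [hre]; exact hu.2)
      (by rwa [him, hy]) fun ρ hz hρ => by
        rw [him, hy]
        refine (hgap ρ hz hρ).trans ?_
        have h1 := abs_im_le_norm ((u : ℂ) + y * I - ρ)
        rw [sub_im, him] at h1
        rw [← hy]
        exact (abs_abs_sub_abs_le y ρ.im).trans h1
    rw [norm_phi0Fun hx0, hre, Hext_eq_H hne]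
    rw [him, hy] at hb
    calc ‖H (u + y * I)‖ * x ^ (u / 2) ≤ Real.exp (-Real.log x) * x ^ (1 : ℝ) := by
          gcongr
          · exact hb.trans (Real.exp_le_exp.2 (by linarith))
          · linarith [hu.2]
      _ = 1 := by
          rw [Real.exp_neg, Real.exp_log hx0, Real.rpow_one, inv_mul_cancel₀ hx0.ne']
  refine (intervalIntegral.norm_integral_le_of_norm_le_const hbound).trans ?_
  norm_num [abs_of_pos]

/-- The quasi-exact formula: the line `Re s = 2` is moved to `Re s = 1/3`, where the integral is
`O(x^(1/6))`; the tails and the horizontal segments are `O(1)`. -/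
lemma exists_norm_phi0_sub_le (hRH : RiemannHypothesis) (hSH : SimplicityHypothesis) :
    ∃ x₀ C : ℝ, ∀ x : ℝ, x₀ < x → ∃ T : ℝ, Real.log x ≤ T ∧ T ≤ Real.log x + 1 ∧
      ∀ σ : ℝ, 1 / 2 < σ → ‖phi0 σ x - (-cZero * (x : ℂ) ^ (1 / 4 : ℂ) +
        ∑ ρ ∈ criticalZeros T, cRes ρ * (x : ℂ) ^ (ρ / 2))‖ ≤ C * x ^ (1 / 6 : ℝ) := by
  obtain ⟨a₀, hheight⟩ := exists_height
  obtain ⟨t₀, h2, hH⟩ := exists_norm_H_le hRH (show (0 : ℝ) < 56 by norm_num) 2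
  obtain ⟨t₁, -, hline⟩ := exists_line_bound hRH (σ := 2) (by norm_num) (by norm_num)
  obtain ⟨x₁, hx₁⟩ := ((Real.tendsto_log_atTop.eventually_ge_atTop
    (max a₀ (max t₀ t₁))).and (eventually_ge_atTop 1)).exists_forall_of_atTop
  set V : ℝ := ∫ t : ℝ, ‖phi0Fun 1 ((1 / 3 : ℝ) + t * I)‖
  refine ⟨x₁, V + 6, fun x hx => ?_⟩
  obtain ⟨hlog, hx1⟩ := hx₁ x hx.le
  have hx0 : 0 < x := by linarith
  obtain ⟨T, hT, hgap⟩ := hheight (Real.log x) ((le_max_left _ _).trans hlog)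
  have ht₀ : t₀ ≤ T := ((le_max_left _ _).trans ((le_max_right _ _).trans hlog)).trans hT.1
  have ht₁ : t₁ ≤ T := ((le_max_right _ _).trans ((le_max_right _ _).trans hlog)).trans hT.1
  have hT0 : 0 < T := by linarith
  refine ⟨T, hT.1, hT.2, fun σ hσ => ?_⟩
  rw [phi0_eq_phi0_two hRH hx0 hσ]
  set S : ℂ := -cZero * (x : ℂ) ^ (1 / 4 : ℂ) +
    ∑ ρ ∈ criticalZeros T, cRes ρ * (x : ℂ) ^ (ρ / 2)
  have hlogT : 0 < Real.log T := Real.log_pos (by linarith)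
  have hrect := rectIntegral_phi0Fun hRH hSH hx0 hT0 fun ρ hz hre h => by
    have h1 := hgap ρ hz hre
    rw [h, sub_self, abs_zero] at h1
    have : 0 < 1 / (56 * Real.log T) := by positivity
    linarith
  set J : ℂ := ∫ t : ℝ, phi0Fun x ((2 : ℝ) + t * I)
  set R : ℂ := ∫ t in -T..T, phi0Fun x ((2 : ℝ) + t * I)
  set L : ℂ := ∫ t in -T..T, phi0Fun x ((1 / 3 : ℝ) + t * I)
  set B : ℂ := ∫ u in (1 / 3 : ℝ)..2, phi0Fun x (u + (-T : ℝ) * I)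
  set D : ℂ := ∫ u in (1 / 3 : ℝ)..2, phi0Fun x (u + T * I)
  have hrect' : B - D + I * R - I * L = 2 * Real.pi * I * S := hrect
  have hB : ‖B‖ ≤ 2 := norm_horizontal_le hx1 hT.1 h2 ht₀ hH hgap (by rw [abs_neg, abs_of_pos hT0])
  have hD : ‖D‖ ≤ 2 := norm_horizontal_le hx1 hT.1 h2 ht₀ hH hgap (abs_of_pos hT0)
  have hJ : ‖J - R‖ ≤ 2 := by
    have h1 := (integrable_and_norm_integral_sub_le
      (continuous_phi0Fun_line hRH hx0 (σ := 2) (by norm_num) (by norm_num)) hT0.le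
      fun t ht => hline x hx0 t (ht₁.trans ht)).2
    refine h1.trans ?_
    have h3 : Real.exp (-T) ≤ x⁻¹ := by
      rw [← Real.exp_log hx0, ← Real.exp_neg]
      exact Real.exp_le_exp.2 (by simpa using hT.1)
    calc 2 * x ^ ((2 : ℝ) / 2) * Real.exp (-T) ≤ 2 * x ^ ((2 : ℝ) / 2) * x⁻¹ := by gcongr
      _ = 2 := by rw [div_self two_ne_zero, Real.rpow_one]; field_simp
  have hL : ‖L‖ ≤ V * x ^ (1 / 6 : ℝ) := by
    have hint := (integrable_phi0Fun_line hRH (σ := 1 / 3) one_pos le_rfl (by norm_num)).norm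
    have hnorm (t : ℝ) : ‖phi0Fun x ((1 / 3 : ℝ) + t * I)‖
        = ‖phi0Fun 1 ((1 / 3 : ℝ) + t * I)‖ * x ^ (1 / 6 : ℝ) := by
      rw [norm_phi0Fun hx0, norm_phi0Fun one_pos, Real.one_rpow, mul_one]
      norm_num
    calc ‖L‖ ≤ ∫ t in -T..T, ‖phi0Fun x ((1 / 3 : ℝ) + t * I)‖ :=
          intervalIntegral.norm_integral_le_integral_norm (by linarith)
      _ = (∫ t in -T..T, ‖phi0Fun 1 ((1 / 3 : ℝ) + t * I)‖) * x ^ (1 / 6 : ℝ) := by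
          simp_rw [hnorm]
          rw [intervalIntegral.integral_mul_const]
      _ ≤ V * x ^ (1 / 6 : ℝ) := by
          gcongr
          rw [intervalIntegral.integral_of_le (by linarith)]
          exact setIntegral_le_integral hint (Eventually.of_forall fun t => norm_nonneg _)
  have hpi : (Real.pi : ℂ) ≠ 0 := ofReal_ne_zero.2 Real.pi_ne_zero
  have hmain : (2 * (Real.pi : ℂ))⁻¹ * J - S
      = (2 * (Real.pi : ℂ))⁻¹ * ((J - R) + L + I * (B - D)) := by
    have h3 : S = (2 * (Real.pi : ℂ))⁻¹ * (R - L - I * (B - D)) := by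
      have h4 : 2 * Real.pi * S = R - L - I * (B - D) := by
        have h5 : I * (2 * Real.pi * S) = I * (R - L - I * (B - D)) := by
          linear_combination -hrect' + (B - D) * I_mul_I
        exact mul_left_cancel₀ I_ne_zero h5
      rw [← h4]
      field_simp
    rw [h3]
    ring
  have hx6 : 1 ≤ x ^ (1 / 6 : ℝ) := Real.one_le_rpow hx1 (by norm_num)
  have hinv : ‖(2 * (Real.pi : ℂ))⁻¹‖ ≤ 1 := by
    rw [norm_inv, norm_mul, norm_ofNat, norm_real, Real.norm_eq_abs, abs_of_pos Real.pi_pos]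
    exact inv_le_one_of_one_le₀ (by linarith [Real.pi_gt_three])
  rw [hmain, norm_mul]
  calc _ ≤ 1 * (‖J - R‖ + ‖L‖ + ‖I * (B - D)‖) := by
        gcongr
        exact norm_add₃_le
    _ ≤ 1 * (2 + V * x ^ (1 / 6 : ℝ) + 4) := by
        gcongr
        rw [norm_mul, norm_I, one_mul]
        linarith [norm_sub_le B D]
    _ ≤ (V + 6) * x ^ (1 / 6 : ℝ) := by nlinarith

end LiouvillePhi

theorem propositionR
    (hRH : RiemannHypothesis) (hSH : LiouvillePhi.SimplicityHypothesis) :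
    -- the defining integral of `φ₀(x)` converges absolutely on every line `Re s = σ > 1/2`
    (∀ σ : ℝ, 1 / 2 < σ → ∀ x : ℝ, 0 < x →
      MeasureTheory.Integrable (LiouvillePhi.phi0Integrand σ x)) ∧
    -- the values of the residues
    LiouvillePhi.cZero =
      -(1 / 2) * (LiouvillePhi.eta (1 / 2) / riemannZeta (1 / 2)) * Complex.Gamma (1 / 2) ∧
    (∀ ρ : ℂ, riemannZeta ρ = 0 → ρ.re = 1 / 2 →
      LiouvillePhi.cRes ρ =
        LiouvillePhi.eta ρ * (riemannZeta (2 * ρ) / deriv riemannZeta ρ) * Complex.Gamma ρ) ∧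
    -- the quasi-exact formula, whichever line `Re s = σ > 1/2` is used to write `φ₀(x)`
    ∃ x₀ C : ℝ, ∀ x : ℝ, x₀ < x →
      ∃ T : ℝ, Real.log x ≤ T ∧ T ≤ Real.log x + 1 ∧
        ∀ σ : ℝ, 1 / 2 < σ →
          ‖LiouvillePhi.phi0 σ x -
            (-LiouvillePhi.cZero * (x : ℂ) ^ (1 / 4 : ℂ) +
              ∑ ρ ∈ LiouvillePhi.criticalZeros T, LiouvillePhi.cRes ρ * (x : ℂ) ^ (ρ / 2))‖
            ≤ C * x ^ (1 / 6 : ℝ) := by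
  refine ⟨fun σ hσ x hx => ?_, ?_, fun ρ hz hre => LiouvillePhi.residue_H_zero hSH hz hre,
    LiouvillePhi.exists_norm_phi0_sub_le hRH hSH⟩
  · exact (MeasureTheory.integrable_congr (LiouvillePhi.phi0Integrand_ae_eq σ x)).2
      (LiouvillePhi.integrable_phi0Fun_line hRH hx (by linarith) hσ.ne')
  · rw [LiouvillePhi.cZero, LiouvillePhi.residue_H_one_half]
    ring
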